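/- **Theorem 4.6 (maximum random walk representation).** Let $E=\{1,\dots,N\}$ and let $J$ be a càdlàg continuous-time Markov chain on $E$ with intensity matrix $Q=(q_{ij})$; let $T_1<T_2<\cdots$ be its jump epochs. Let $N_t$ be a Markov modulated Poisson process with arrival intensity $\lambda_i\ge 0$ while $J_t=i$ (that is, conditionally on $J$, it is a Poisson process with intensity $\lambda_{J_t}$ at time $t$), with arrival epochs $T^N_1<T^N_2<\cdots$. Let $C^{(i)}_k$ and $C^{(ij)}_k$ ($k\ge1$, $i,j\in E$) be non-negative random variables with distributions $F^{(i)}_C$ and $F^{(ij)}_C$ respectively, independent of each other and of $(J,N)$. Let $p_i>0$ be the premium intensities, and assume $\lambda_i-q_{ii}>0$ for all $i\in E$. The risk process with initial capital $x$ is $$X_t=x+\int_0^t p_{J_u}\,du-\sum_{k=1}^{N_t}C_k^{(J_{T^N_k})}-\sum_{k:\,T_k\le t}C_k^{(J_{T_k-},J_{T_k})}.$$ Write $\mathbb P_{x,i}$ for the law given $X_0=x$, $J_0=i$, and $\mathbb P_i=\mathbb P_{0,i}$. Assume the net profit condition $\mathbb E_i X_1>0$ for all $i\in E$. Let $\tau_0^-=\inf\{t\ge0: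 X_t<0\}$ and let $\phi_i(x)=\mathbb P_{x,i}(\tau_0^-<\infty)$ be the ruin probability. Let $T^C_0=0$ and let $T^C_1<T^C_2<\cdots$ be the successive jump epochs of the risk process (the times that are an arrival epoch $T^N_l$ or a jump epoch $T_l$ of $J$). Put $\xi_k=X_{T^C_{k-1}}-X_{T^C_k}$, and let $S_0=0$, $S_n=\sum_{k=1}^n\xi_k$ be the embedded Markov modulated random walk. Then for every $i\in E$ the maximum $\max_{k\ge0}S_k$ is attained $\mathbb P_i$-almost surely, and for every $x\ge0$ $$\phi_i(x)=\mathbb P_i\Big(\max_{k\ge0}S_k>x\Big)<1 .$$ -/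

import Mathlib

open MeasureTheory ProbabilityTheory Filter Topology Set
open scoped NNReal ENNReal

noncomputable section

namespace MMRisk

/-- The set of jump times of a path `f`: the times `t` at which `f (t-) ≠ f t`.
(By the convention of `Function.leftLim`, `f (0-) = f 0`, so `0` is never a jump time.) -/
def jumpSet {S : Type*} [TopologicalSpace S] (f : ℝ≥0 → S) : Set ℝ≥0 :=
  {t | Function.leftLim f t ≠ f t}

/-- The successive elements of a locally finite set of positive times: `epoch D 0 = 0` and
`epoch D (k + 1) = inf {t ∈ D : t > epoch D k}`, which is `∞` if there is no such `t`. -/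
def epoch (D : Set ℝ≥0) : ℕ → ℝ≥0∞
  | 0 => 0
  | k + 1 => ⨅ t ∈ D, ⨅ _ : epoch D k < (t : ℝ≥0∞), (t : ℝ≥0∞)

/-- The parameters of the model, with environment states `E = Fin n`: intensity matrix `Q`,
premium intensities `p`, claim arrival intensities `lam`, laws `F i` of the claims that arrive
in state `i`, and laws `G i j` of the claims caused by a transition from `i` to `j`. -/
structure Params (n : ℕ) where
  Q : Matrix (Fin n) (Fin n) ℝ
  p : Fin n → ℝ
  lam : Fin n → ℝ
  F : Fin n → Measure ℝ
  G : Fin n → Fin n → Measure ℝ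
  Q_nonneg : ∀ i j, i ≠ j → 0 ≤ Q i j
  Q_rowSum : ∀ i, ∑ j, Q i j = 0
  p_pos : ∀ i, 0 < p i
  lam_nonneg : ∀ i, 0 ≤ lam i
  rate_pos : ∀ i, 0 < lam i - Q i i
  F_prob : ∀ i, IsProbabilityMeasure (F i)
  G_prob : ∀ i j, IsProbabilityMeasure (G i j)
  F_nonneg : ∀ i, F i (Iio 0) = 0
  G_nonneg : ∀ i j, G i j (Iio 0) = 0

/-- `J` is, under the measures `P i`, a continuous-time Markov chain with càdlàg paths,
intensity matrix `Q` and initial state `i`: its finite-dimensional distributions are given by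
the transition matrices `exp (t Q)`. -/
structure IsMarkovChain {n : ℕ} {Ω : Type*} [MeasurableSpace Ω]
    (Q : Matrix (Fin n) (Fin n) ℝ) (P : Fin n → Measure Ω) (J : ℝ≥0 → Ω → Fin n) : Prop where
  measurable : ∀ t, Measurable (J t)
  rightCont : ∀ ω t, ContinuousWithinAt (fun s => J s ω) (Ici t) t
  leftLimit : ∀ ω t, ∃ j, Tendsto (fun s => J s ω) (𝓝[<] t) (𝓝 j)
  law : ∀ (i : Fin n) (m : ℕ) (t : ℕ → ℝ≥0) (s : ℕ → Fin n), Monotone t → t 0 = 0 →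
    P i {ω | ∀ k ≤ m, J (t k) ω = s k} =
      (if s 0 = i then 1 else 0) * ∏ k ∈ Finset.range m,
        ENNReal.ofReal
          (NormedSpace.exp (((t (k + 1) : ℝ) - (t k : ℝ)) • Q) (s k) (s (k + 1)))

/-- The σ-algebra generated by a family of functions. -/
abbrev sigma {ι Ω S : Type*} [MeasurableSpace S] (Z : ι → Ω → S) : MeasurableSpace Ω :=
  ⨆ a, MeasurableSpace.comap (Z a) inferInstance

/-- `N` is a Markov modulated Poisson process with intensity `lam i` while `J` is in state `i`:
a counting process with unit jumps whose increments over disjoint intervals `(s, t]` are,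
conditionally on the whole path of `J`, independent and Poisson distributed with mean
`∫ u in s..t, lam (J u)`. -/
structure IsModulatedPoisson {n : ℕ} {Ω : Type*} [MeasurableSpace Ω]
    (lam : Fin n → ℝ) (P : Fin n → Measure Ω) (J : ℝ≥0 → Ω → Fin n)
    (N : ℝ≥0 → Ω → ℕ) : Prop where
  measurable : ∀ t, Measurable (N t)
  zero : ∀ ω, N 0 ω = 0
  mono : ∀ ω, Monotone (fun t => N t ω)
  rightCont : ∀ ω t, ContinuousWithinAt (fun s => N s ω) (Ici t) t
  unitJumps : ∀ ω t, N t ω ≤ Function.leftLim (fun s => N s ω) t + 1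
  law : ∀ (i : Fin n) (m : ℕ) (t : ℕ → ℝ≥0) (c : ℕ → ℕ) (A : Set Ω), Monotone t →
    MeasurableSet[sigma J] A →
    P i (A ∩ {ω | ∀ k < m, N (t (k + 1)) ω = N (t k) ω + c k}) =
      ∫⁻ ω in A, ∏ k ∈ Finset.range m, ENNReal.ofReal
        (Real.exp (-∫ u in (t k : ℝ)..(t (k + 1) : ℝ), lam (J u.toNNReal ω)) *
          (∫ u in (t k : ℝ)..(t (k + 1) : ℝ), lam (J u.toNNReal ω)) ^ (c k) /
            (Nat.factorial (c k) : ℝ)) ∂(P i)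

/-- All claims as one family: `C k i`, then `D k i j`. -/
def allClaims {n : ℕ} {Ω : Type*} (C : ℕ → Fin n → Ω → ℝ) (D : ℕ → Fin n → Fin n → Ω → ℝ) :
    (ℕ × Fin n) ⊕ (ℕ × Fin n × Fin n) → Ω → ℝ :=
  Sum.elim (fun a => C a.1 a.2) (fun b => D b.1 b.2.1 b.2.2)

/-- The random ingredients of the Markov modulated risk model. `P i` is the probability measure
under which the environment starts in state `i`. `C k i` is the size of the `k`-th arriving claim
if it arrives in state `i`; `D k i j` is the size of the claim at the `k`-th jump of the
environment if this jump leads from `i` to `j` (`k ≥ 1`). All claims are independent of each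
other and of the pair `(J, N)`. -/
structure Model {n : ℕ} (θ : Params n) (Ω : Type*) [MeasurableSpace Ω] where
  P : Fin n → Measure Ω
  J : ℝ≥0 → Ω → Fin n
  N : ℝ≥0 → Ω → ℕ
  C : ℕ → Fin n → Ω → ℝ
  D : ℕ → Fin n → Fin n → Ω → ℝ
  prob : ∀ i, IsProbabilityMeasure (P i)
  chain : IsMarkovChain θ.Q P J
  arrivals : IsModulatedPoisson θ.lam P J N
  C_measurable : ∀ k j, Measurable (C k j)
  D_measurable : ∀ k j l, Measurable (D k j l)
  C_law : ∀ i k j, (P i).map (C k j) = θ.F j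
  D_law : ∀ i k j l, (P i).map (D k j l) = θ.G j l
  claims_iIndep : ∀ i, iIndepFun (allClaims C D) (P i)
  claims_indep : ∀ i, Indep (sigma (allClaims C D)) (sigma J ⊔ sigma N) (P i)

namespace Model

variable {n : ℕ} {θ : Params n} {Ω : Type*} [MeasurableSpace Ω] (R : Model θ Ω)

/-- `T_k`, the `k`-th jump epoch of the environment `J` (`k ≥ 1`). -/
def envEpoch (k : ℕ) (ω : Ω) : ℝ≥0∞ := epoch (jumpSet fun t => R.J t ω) k

/-- The `k`-th jump epoch of the arrival process `N` (`k ≥ 1`). -/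
def arrivalEpoch (k : ℕ) (ω : Ω) : ℝ≥0∞ := epoch (jumpSet fun t => R.N t ω) k

/-- The number of jumps of the environment up to time `t`. -/
def envCount (t : ℝ≥0) (ω : Ω) : ℕ := ((jumpSet fun s => R.J s ω) ∩ Iic t).ncard

/-- The risk process `X_t` with initial capital `x`. Under `R.P i` the pair `(R.X x, R.J)` has
the law of `(X, J)` given `X_0 = x`, `J_0 = i`. -/
def X (x : ℝ) (t : ℝ≥0) (ω : Ω) : ℝ :=
  x + (∫ u in (0 : ℝ)..(t : ℝ), θ.p (R.J u.toNNReal ω))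
    - ∑ k ∈ Finset.Icc 1 (R.N t ω), R.C k (R.J (R.arrivalEpoch k ω).toNNReal ω) ω
    - ∑ k ∈ Finset.Icc 1 (R.envCount t ω),
        R.D k (Function.leftLim (fun s => R.J s ω) (R.envEpoch k ω).toNNReal)
          (R.J (R.envEpoch k ω).toNNReal ω) ω

/-- The net profit condition: `E_i X_1 > 0` for every initial state `i`, with `X_0 = 0`.
(Strict positivity of the Bochner integral includes integrability.) -/
def NetProfit : Prop := ∀ i, 0 < ∫ ω, R.X 0 1 ω ∂(R.P i)

/-- The ruin time `inf {t ≥ 0 : X_t < 0}`, with value `∞` if there is no such `t`. -/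
def ruinTime (x : ℝ) (ω : Ω) : ℝ≥0∞ := ⨅ (t : ℝ≥0) (_ : R.X x t ω < 0), (t : ℝ≥0∞)

/-- The ruin probability with initial capital `x` and initial state `i`. -/
def ruinProb (i : Fin n) (x : ℝ) : ℝ≥0∞ := R.P i {ω | R.ruinTime x ω < ∞}

/-- The jump epochs of the risk process: `0`, followed by the successive times at which a claim
arrives or the environment jumps. They are almost surely all finite. -/
def claimEpoch (k : ℕ) (ω : Ω) : ℝ≥0∞ :=
  epoch ((jumpSet fun t => R.N t ω) ∪ (jumpSet fun t => R.J t ω)) k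

/-- The `k`-th step (`k ≥ 1`) of the embedded walk: the negative of the increment of the risk
process (with `X_0 = 0`) between consecutive jump epochs. -/
def step (k : ℕ) (ω : Ω) : ℝ :=
  R.X 0 (R.claimEpoch (k - 1) ω).toNNReal ω - R.X 0 (R.claimEpoch k ω).toNNReal ω

/-- The embedded Markov modulated random walk. -/
def walk (m : ℕ) (ω : Ω) : ℝ := ∑ k ∈ Finset.Icc 1 m, R.step k ω

/-- The all-time maximum of the walk, as a supremum of extended reals. -/
def walkMax (ω : Ω) : EReal := ⨆ m : ℕ, (R.walk m ω : EReal)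

end Model

end MMRisk

end

/-! Two facts hold path by path. Premiums only raise `X` between events, and at the `k`-th event the
process started from 0 equals `-S_k`; hence the process started from `x` becomes negative if and
only if some `S_k` exceeds `x` (`ruinTime_lt_top_iff`). If the process started from 0 is nonnegative
from some time on, all but finitely many `S_k` are at most `S_0 = 0`, so the maximum is attained
(`exists_walkMax_eq`). What remains is probabilistic: started from 0, the process is almost surely
eventually nonnegative, and with positive probability it is never negative.

Both follow from observing the process over unit intervals. The cells (state at the end, number of
events, increment of `X`) form a Markov additive sequence: given the first cell, the rest is
distributed as a fresh sequence started in the state reached (`renewal_unitCell`). Such a sequence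
can be drawn from independent rows of i.i.d. cells, one row per state. The strong law holds in each
row, and net profit makes each row mean positive, so the sums tend to infinity however the visits
are shared among the states (`Renewal.tendsto_sum`); neither irreducibility nor a stationary law is
needed. Since claims are nonnegative and premium rates bounded, the integer times control all times
(`X_ge_next`). For the strict inequality, `M` unit intervals without events have positive
probability (`prob_unitCell_still_pos`) and earn premiums proportional to `M`. The sequence then
restarts, and with positive probability its sums never fall below a fixed level, which these
premiums cover for large `M`.

The bulk of the work is `renewal_unitCell`. The model provides finite-dimensional laws of `J`, the
conditional Poisson law of increments of `N`, and independent claims, not a Markov property on path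
space. On a grid the cylinder probabilities can be computed and they factor (`prob_gridCell`). The
product form yields the Markov additive property (`ProductLaw.renewal`), which survives aggregation
of cells (`Renewal.block`) and pointwise limits (`Renewal.of_tendsto`). A fine grid separates all
events of a path on a bounded interval, so the aggregated grid cells converge to the unit cells
(`tendsto_block_gridCell`). The same scheme is first applied to the integrated intensity
(`renewal_functionalCell`), which supplies the Poisson means. -/

noncomputable section

namespace MMRisk

/-! ### Laws of Markov additive sequences -/

/-- The data of one time cell: the state of the environment at the end of the cell, the number
of events in the cell and the increment over the cell. -/
abbrev Site (n : ℕ) := (Fin n × ℕ) × ℝ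

/-- The sequences without their first entry. -/
def shift {S : Type*} (x : ℕ → S) : ℕ → S := fun k => x (k + 1)

@[fun_prop]
lemma measurable_shift {S : Type*} [MeasurableSpace S] : Measurable (shift (S := S)) :=
  measurable_pi_lambda _ fun k => measurable_pi_apply (k + 1)

@[fun_prop]
lemma continuous_shift {S : Type*} [TopologicalSpace S] : Continuous (shift (S := S)) :=
  continuous_pi fun k => continuous_apply (k + 1)

/-- The cell sequences whose first `m` marks are `d` and whose increments lie in `B`. -/
def cyl {n : ℕ} (m : ℕ) (d : ℕ → Fin n × ℕ) (B : ℕ → Set ℝ) : Set (ℕ → Site n) :=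
  {x | ∀ k < m, (x k).1 = d k ∧ (x k).2 ∈ B k}

variable {n : ℕ}

lemma cyl_eq_iInter (m : ℕ) (d : ℕ → Fin n × ℕ) (B : ℕ → Set ℝ) :
    cyl m d B = ⋂ k ∈ Finset.range m, (fun x : ℕ → Site n => x k) ⁻¹' ({d k} ×ˢ B k) := by
  ext x
  simp [cyl]

lemma measurableSet_cyl {m : ℕ} {d : ℕ → Fin n × ℕ} {B : ℕ → Set ℝ}
    (hB : ∀ k, MeasurableSet (B k)) : MeasurableSet (cyl m d B) := by
  rw [cyl_eq_iInter]
  exact Finset.measurableSet_biInter _ fun k _ =>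
    measurable_pi_apply k ((measurableSet_singleton _).prod (hB k))

/-- Two cylinders with a common point `y` prescribe equal marks on their common range, so their
intersection is a cylinder of the greater length. -/
lemma isPiSystem_cyl : IsPiSystem {s : Set (ℕ → Site n) |
    ∃ m d B, (∀ k, MeasurableSet (B k)) ∧ s = cyl m d B} := by
  rintro _ ⟨m, d, B, hB, rfl⟩ _ ⟨m', d', B', hB', rfl⟩ ⟨y, hy, hy'⟩
  refine ⟨max m m', fun k => if k < m then d k else d' k,
    fun k => (if k < m then B k else univ) ∩ (if k < m' then B' k else univ), fun k => ?_, ?_⟩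
  · refine MeasurableSet.inter ?_ ?_ <;> split_ifs <;> simp [hB, hB']
  · ext x
    constructor
    · rintro ⟨h, h'⟩ k hk
      by_cases h1 : k < m <;> by_cases h2 : k < m'
      · simp [h1, h2, h k h1, h' k h2]
      · simp [h1, h2, h k h1]
      · simp [h1, h2, h' k h2]
      · omega
    · intro h
      refine ⟨fun k hk => ?_, fun k hk => ?_⟩
      · have := h k (by omega)
        simp only [hk, if_true] at this
        exact ⟨this.1, this.2.1⟩
      · have := h k (by omega)
        by_cases h1 : k < m
        · simp only [hk, h1, if_true] at this
          exact ⟨by rw [this.1, ← (hy k h1).1, (hy' k hk).1], this.2.2⟩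
        · simp only [hk, h1, if_true, if_false] at this
          exact ⟨this.1, this.2.2⟩

/-- A condition on one coordinate is a countable union of cylinders, over all possible marks of the
earlier coordinates. -/
lemma generateFrom_cyl : (inferInstance : MeasurableSpace (ℕ → Site n)) =
    MeasurableSpace.generateFrom {s : Set (ℕ → Site n) |
      ∃ m d B, (∀ k, MeasurableSet (B k)) ∧ s = cyl m d B} := by
  apply le_antisymm
  · set C := {s : Set (ℕ → Site n) | ∃ m d B, (∀ k, MeasurableSet (B k)) ∧ s = cyl m d B}
    have key : ∀ (k : ℕ) (d : Fin n × ℕ) (B : Set ℝ), MeasurableSet B →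
        MeasurableSet[MeasurableSpace.generateFrom C] {x | (x k).1 = d ∧ (x k).2 ∈ B} := by
      intro k d B hB
      have : {x : ℕ → Site n | (x k).1 = d ∧ (x k).2 ∈ B} =
          ⋃ e : Fin k → Fin n × ℕ, cyl (k + 1) (fun a => if h : a < k then e ⟨a, h⟩ else d)
            (fun a => if a < k then univ else B) := by
        ext x
        simp only [mem_ofPred_eq, mem_iUnion]
        constructor
        · rintro ⟨h1, h2⟩
          refine ⟨fun a => (x a).1, fun a ha => ?_⟩
          rcases Nat.lt_succ_iff_lt_or_eq.1 ha with h | rfl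
          · simp [h]
          · simp [h1, h2]
        · rintro ⟨e, he⟩
          simpa using he k (Nat.lt_succ_self k)
      rw [this]
      refine MeasurableSet.iUnion fun e => MeasurableSpace.measurableSet_generateFrom
        ⟨_, _, _, fun a => ?_, rfl⟩
      split_ifs <;> simp [hB]
    refine iSup_le fun k => ?_
    have h1 : @Measurable _ _ (MeasurableSpace.generateFrom C) _ fun x : ℕ → Site n => (x k).1 := by
      let _ := MeasurableSpace.generateFrom C
      refine measurable_to_countable' fun d => ?_
      have : (fun x : ℕ → Site n => (x k).1) ⁻¹' {d} = {x | (x k).1 = d ∧ (x k).2 ∈ univ} := by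
        ext x; simp
      rw [this]
      exact key k d univ MeasurableSet.univ
    have h2 : @Measurable _ _ (MeasurableSpace.generateFrom C) _ fun x : ℕ → Site n => (x k).2 := by
      let _ := MeasurableSpace.generateFrom C
      intro B hB
      have : (fun x : ℕ → Site n => (x k).2) ⁻¹' B =
          ⋃ d : Fin n × ℕ, {x | (x k).1 = d ∧ (x k).2 ∈ B} := by
        ext x; simp
      rw [this]
      exact MeasurableSet.iUnion fun d => key k d B hB
    have h3 : @Measurable _ _ (MeasurableSpace.generateFrom C) _ fun x : ℕ → Site n => x k := by
      let _ := MeasurableSpace.generateFrom C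
      exact h1.prodMk h2
    exact h3.comap_le
  · refine MeasurableSpace.generateFrom_le ?_
    rintro _ ⟨m, d, B, hB, rfl⟩
    exact measurableSet_cyl hB

/-- Finite measures on cell sequences are determined by the cylinder sets. -/
lemma ext_of_cyl {μ ν : Measure (ℕ → Site n)} [IsFiniteMeasure μ]
    (h : ∀ m d B, (∀ k, MeasurableSet (B k)) → μ (cyl m d B) = ν (cyl m d B)) : μ = ν := by
  -- Total masses are compared on the cylinder of length 0, the whole space; writing it down still
  -- requires some mark, hence some state.
  rcases n.eq_zero_or_pos with rfl | hn
  · have : IsEmpty (ℕ → Site 0) := ⟨fun x => (x 0).1.1.elim0⟩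
    exact Measure.ext fun s _ => by simp [Subsingleton.elim s ∅]
  · refine ext_of_generate_finite _ generateFrom_cyl isPiSystem_cyl ?_ ?_
    · rintro _ ⟨m, d, B, hB, rfl⟩
      exact h m d B hB
    · have := h 0 (fun _ => (⟨0, hn⟩, 0)) (fun _ => univ) (fun _ => MeasurableSet.univ)
      simpa [cyl] using this

/-- The state in which cell `k` starts, for initial state `i` and marks `d`. -/
def startState (i : Fin n) (d : ℕ → Fin n × ℕ) : ℕ → Fin n
  | 0 => i
  | k + 1 => (d k).1

/-- The law of the first cell, as a function of rectangles. -/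
def firstSet (d : Fin n × ℕ) (B : Set ℝ) : Set (ℕ → Site n) := {x | (x 0).1 = d ∧ (x 0).2 ∈ B}

lemma measurableSet_firstSet (d : Fin n × ℕ) {B : Set ℝ} (hB : MeasurableSet B) :
    MeasurableSet (firstSet d B) := by
  have : firstSet d B = (fun x : ℕ → Site n => x 0) ⁻¹' ({d} ×ˢ B) := by ext; simp [firstSet]
  rw [this]
  exact measurable_pi_apply 0 ((measurableSet_singleton _).prod hB)

/-- The laws `L i` of cell sequences started in state `i` are Markov additive. -/
def Renewal (L : Fin n → Measure (ℕ → Site n)) : Prop :=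
  ∀ i d B A, MeasurableSet B → MeasurableSet A →
    L i (firstSet d B ∩ shift ⁻¹' A) = L i (firstSet d B) * L d.1 A

/-- The cylinder probabilities are products of one-cell probabilities. -/
def ProductLaw (L : Fin n → Measure (ℕ → Site n)) : Prop :=
  ∀ i m d B, (∀ k, MeasurableSet (B k)) →
    L i (cyl m d B) = ∏ k ∈ Finset.range m, L (startState i d k) (firstSet (d k) (B k))

lemma cyl_succ (m : ℕ) (d : ℕ → Fin n × ℕ) (B : ℕ → Set ℝ) :
    cyl (m + 1) d B = firstSet (d 0) (B 0) ∩ shift ⁻¹' cyl m (shift d) (shift B) := by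
  ext x
  simp only [cyl, firstSet, shift, mem_ofPred_eq, mem_inter_iff, mem_preimage]
  constructor
  · intro h
    exact ⟨h 0 (by omega), fun k hk => h (k + 1) (by omega)⟩
  · rintro ⟨h0, h⟩ (_ | k) hk
    · exact h0
    · exact h k (by omega)

lemma startState_shift (i : Fin n) (d : ℕ → Fin n × ℕ) (k : ℕ) :
    startState (d 0).1 (shift d) k = startState i d (k + 1) := by
  cases k <;> rfl

variable {L : Fin n → Measure (ℕ → Site n)}

lemma Renewal.productLaw [∀ i, IsProbabilityMeasure (L i)] (h : Renewal L) : ProductLaw L := by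
  intro i m d B hB
  induction m generalizing i d B with
  | zero => simp [cyl]
  | succ m ih =>
    rw [cyl_succ, h _ _ _ _ (hB 0) (measurableSet_cyl (B := shift B) fun k => hB (k + 1)),
      ih _ _ (shift B) (fun k => hB (k + 1)), Finset.prod_range_succ', mul_comm]
    congr 1
    exact Finset.prod_congr rfl fun k _ => by rw [startState_shift i]; rfl

/-- For a fixed first cell both sides are finite measures in `A`. On a cylinder they agree, because
prefixing the first cell gives a cylinder one longer and a product with one more factor. -/
lemma ProductLaw.renewal [∀ i, IsProbabilityMeasure (L i)] (h : ProductLaw L) : Renewal L := by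
  intro i d B A hB hA
  have hE := measurableSet_firstSet d hB
  have key : ((L i).restrict (firstSet d B)).map shift = (L i (firstSet d B)) • L d.1 := by
    refine ext_of_cyl fun m d' B' hB' => ?_
    let d'' : ℕ → Fin n × ℕ := fun k => Nat.casesOn k d d'
    let B'' : ℕ → Set ℝ := fun k => Nat.casesOn k B B'
    have hB'' : ∀ k, MeasurableSet (B'' k) := by rintro (_ | k); exacts [hB, hB' k]
    have := cyl_succ m d'' B''
    rw [Measure.map_apply measurable_shift (measurableSet_cyl hB'),
      Measure.restrict_apply (measurable_shift (measurableSet_cyl hB')), inter_comm]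
    change L i (firstSet (d'' 0) (B'' 0) ∩ shift ⁻¹' cyl m (shift d'') (shift B'')) = _
    rw [← this, h i (m + 1) d'' B'' hB'', Finset.prod_range_succ']
    simp only [Measure.smul_apply, smul_eq_mul]
    rw [mul_comm, h d.1 m d' B' hB']
    congr 1
    exact Finset.prod_congr rfl fun k _ => by rw [← startState_shift i]; rfl
  rw [inter_comm, ← Measure.restrict_apply (measurable_shift hA),
    ← Measure.map_apply measurable_shift hA, key]
  rfl

/-- The kernel form of `Renewal`. -/
lemma Renewal.lintegral [∀ i, IsProbabilityMeasure (L i)] (h : Renewal L) (i : Fin n)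
    {F : Site n × (ℕ → Site n) → ℝ≥0∞} (hF : Measurable F) :
    ∫⁻ x, F (x 0, shift x) ∂L i = ∫⁻ x, ∫⁻ y, F (x 0, y) ∂L (x 0).1.1 ∂L i := by
  -- The first mark has countably many values. Once it is fixed, the kernel `L (x 0).1.1` is a
  -- constant law, independent of the first increment, and Fubini for a product measure applies.
  have split : ∀ G : (ℕ → Site n) → ℝ≥0∞,
      ∫⁻ x, G x ∂L i = ∑' d : Fin n × ℕ, ∫⁻ x in firstSet d univ, G x ∂L i := by
    intro G
    rw [← lintegral_iUnion (fun d => measurableSet_firstSet d MeasurableSet.univ)]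
    · have : (⋃ d : Fin n × ℕ, firstSet d univ) = (univ : Set (ℕ → Site n)) := by
        ext x; simp [firstSet]
      rw [this, Measure.restrict_univ]
    · intro d d' hd
      refine disjoint_left.2 fun x hx hx' => hd ?_
      rw [← hx.1, ← hx'.1]
  rw [split, split]
  refine tsum_congr fun d => ?_
  have hE := measurableSet_firstSet d MeasurableSet.univ
  have hm0 : Measurable fun x : ℕ → Site n => (x 0).2 := by fun_prop
  have hmp : Measurable fun x : ℕ → Site n => ((x 0).2, shift x) := by fun_prop
  have key : (((L i).restrict (firstSet d univ)).map fun x => (x 0).2).prod (L d.1) =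
      ((L i).restrict (firstSet d univ)).map fun x => ((x 0).2, shift x) := by
    refine Measure.prod_eq fun B A hB hA => ?_
    rw [Measure.map_apply hmp (hB.prod hA), Measure.map_apply hm0 hB,
      Measure.restrict_apply (hmp (hB.prod hA)), Measure.restrict_apply (hm0 hB)]
    have e1 : (fun x : ℕ → Site n => ((x 0).2, shift x)) ⁻¹' B ×ˢ A ∩ firstSet d univ =
        firstSet d B ∩ shift ⁻¹' A := by
      ext x; simp [firstSet]; tauto
    have e2 : (fun x : ℕ → Site n => (x 0).2) ⁻¹' B ∩ firstSet d univ = firstSet d B := by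
      ext x; simp [firstSet]; tauto
    rw [e1, e2, h i d B A hB hA]
  have hF' : Measurable fun p : ℝ × (ℕ → Site n) => F ((d, p.1), p.2) := by fun_prop
  calc ∫⁻ x in firstSet d univ, F (x 0, shift x) ∂L i
      = ∫⁻ x in firstSet d univ, F ((d, (x 0).2), shift x) ∂L i := by
        refine setLIntegral_congr_fun hE fun x hx => ?_
        change F (((x 0).1, (x 0).2), shift x) = _
        rw [hx.1]
    _ = ∫⁻ p, F ((d, p.1), p.2)
          ∂(((L i).restrict (firstSet d univ)).map fun x => ((x 0).2, shift x)) := by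
        rw [lintegral_map hF' hmp]
    _ = ∫⁻ x in firstSet d univ, ∫⁻ y, F ((d, (x 0).2), y) ∂L d.1 ∂L i := by
        rw [← key, lintegral_prod _ hF'.aemeasurable, lintegral_map hF'.lintegral_prod_right' hm0]
    _ = _ := by
        refine setLIntegral_congr_fun hE fun x hx => ?_
        change _ = ∫⁻ y, F (((x 0).1, (x 0).2), y) ∂L (x 0).1.1
        rw [hx.1]

lemma measurable_lintegral_next [∀ i, IsProbabilityMeasure (L i)]
    {F : Site n × (ℕ → Site n) → ℝ≥0∞} (hF : Measurable F) :
    Measurable fun s : Site n => ∫⁻ y, F (s, y) ∂L s.1.1 := by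
  have : ∀ j : Fin n, Measurable fun s : Site n => ∫⁻ y, F (s, y) ∂L j :=
    fun j => hF.lintegral_prod_right'
  have h2 : Measurable fun p : Site n × Fin n => ∫⁻ y, F (p.1, y) ∂L p.2 :=
    measurable_from_prod_countable_left fun j => this j
  exact h2.comp (measurable_id.prodMk (by fun_prop : Measurable fun s : Site n => s.1.1))

/-! ### Aggregating cells -/

/-- The first `r + 1` cells, aggregated into one. -/
def agg (r : ℕ) (x : ℕ → Site n) : Site n :=
  (((x r).1.1, ∑ a ∈ Finset.range (r + 1), (x a).1.2), ∑ a ∈ Finset.range (r + 1), (x a).2)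

@[fun_prop]
lemma measurable_agg (r : ℕ) : Measurable (agg (n := n) r) := by
  unfold agg
  fun_prop

lemma iterate_shift {S : Type*} (r : ℕ) (x : ℕ → S) (k : ℕ) : (shift^[r] x) k = x (k + r) := by
  induction r generalizing x with
  | zero => rfl
  | succ r ih => rw [Function.iterate_succ_apply, ih]; simp only [shift]; congr 1

@[fun_prop]
lemma measurable_iterate_shift {S : Type*} [MeasurableSpace S] (r : ℕ) :
    Measurable (shift (S := S))^[r] :=
  measurable_shift.iterate r

/-- Aggregation of consecutive groups of `r + 1` cells. -/
def block (r : ℕ) (x : ℕ → Site n) : ℕ → Site n := fun k => agg r (shift^[k * (r + 1)] x)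

lemma block_shift (r : ℕ) (x : ℕ → Site n) : shift (block r x) = block r (shift^[r + 1] x) := by
  funext k
  simp only [shift, block]
  rw [← Function.iterate_add_apply]
  congr 2
  ring

@[fun_prop]
lemma measurable_block (r : ℕ) : Measurable (block (n := n) r) :=
  measurable_pi_lambda _ fun _ => (measurable_agg r).comp (measurable_iterate_shift _)

/-- Induction on the number of cells: the aggregate ends in the state of its last cell, so the
sequence restarts there and its next cell can be absorbed. The induction hypothesis is used forwards
to restart and backwards to reassemble. -/
lemma Renewal.lintegral_agg [∀ i, IsProbabilityMeasure (L i)] (h : Renewal L) (i : Fin n) (r : ℕ)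
    {F : Site n × (ℕ → Site n) → ℝ≥0∞} (hF : Measurable F) :
    ∫⁻ x, F (agg r x, shift^[r + 1] x) ∂L i =
      ∫⁻ x, ∫⁻ y, F (agg r x, y) ∂L (agg r x).1.1 ∂L i := by
  induction r generalizing F with
  | zero => simpa [agg, iterate_shift] using! h.lintegral i hF
  | succ r ih =>
    let comb : Site n × Site n → Site n := fun p =>
      ((p.2.1.1, p.1.1.2 + p.2.1.2), p.1.2 + p.2.2)
    have hc : Measurable comb := by fun_prop
    have hagg : ∀ x : ℕ → Site n, agg (r + 1) x = comb (agg r x, (shift^[r + 1] x) 0) := by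
      intro x
      rw [iterate_shift]
      simp [agg, comb, Finset.sum_range_succ]
    let H : Site n → ℝ≥0∞ := fun s => ∫⁻ y, F (s, y) ∂L s.1.1
    have hH : Measurable H := measurable_lintegral_next hF
    calc ∫⁻ x, F (agg (r + 1) x, shift^[r + 1 + 1] x) ∂L i
        = ∫⁻ x, (fun p : Site n × (ℕ → Site n) => F (comb (p.1, p.2 0), shift p.2))
            (agg r x, shift^[r + 1] x) ∂L i := by
          refine lintegral_congr fun x => ?_
          simp only [hagg, ← Function.iterate_succ_apply']
      _ = ∫⁻ x, ∫⁻ y, F (comb (agg r x, y 0), shift y) ∂L (agg r x).1.1 ∂L i :=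
          ih (F := fun p : Site n × (ℕ → Site n) => F (comb (p.1, p.2 0), shift p.2)) (by fun_prop)
      _ = ∫⁻ x, ∫⁻ y, H (comb (agg r x, y 0)) ∂L (agg r x).1.1 ∂L i := by
          refine lintegral_congr fun x => ?_
          exact h.lintegral (agg r x).1.1
            (F := fun p : Site n × (ℕ → Site n) => F (comb (agg r x, p.1), p.2)) (by fun_prop)
      _ = ∫⁻ x, (fun p : Site n × (ℕ → Site n) => H (comb (p.1, p.2 0)))
            (agg r x, shift^[r + 1] x) ∂L i :=
          (ih (F := fun p : Site n × (ℕ → Site n) => H (comb (p.1, p.2 0))) (by fun_prop)).symm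
      _ = ∫⁻ x, H (agg (r + 1) x) ∂L i := by
          refine lintegral_congr fun x => ?_
          simp only [hagg]

/-- This is the restart at multiples of `r + 1`: dropping one block drops `r + 1` cells, and
`Renewal.lintegral_agg` is applied to an indicator. -/
lemma Renewal.block [∀ i, IsProbabilityMeasure (L i)] (h : Renewal L) (r : ℕ) :
    Renewal fun i => (L i).map (block r) := by
  intro i d B A hB hA
  have hE := measurableSet_firstSet (n := n) d hB
  have hb := measurable_block (n := n) r
  rw [Measure.map_apply hb (hE.inter (measurable_shift hA)), Measure.map_apply hb hE,
    Measure.map_apply hb hA]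
  have hR : MeasurableSet ({d} ×ˢ B : Set (Site n)) := (measurableSet_singleton _).prod hB
  have e2 : MMRisk.block r ⁻¹' firstSet d B = agg r ⁻¹' ({d} ×ˢ B) := by
    ext x; simp [firstSet, MMRisk.block]
  have e1 : MMRisk.block r ⁻¹' (firstSet d B ∩ shift ⁻¹' A) =
      (fun x => (agg r x, shift^[r + 1] x)) ⁻¹' (({d} ×ˢ B) ×ˢ (MMRisk.block r ⁻¹' A)) := by
    rw [preimage_inter, e2, preimage_preimage]
    ext x
    simp [block_shift]
  have hm : Measurable fun x : ℕ → Site n => (agg r x, shift^[r + 1] x) := by fun_prop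
  have hR2 := hR.prod (hb hA)
  rw [e1, e2, ← lintegral_indicator_one (hm hR2)]
  have := h.lintegral_agg i r (F := indicator (({d} ×ˢ B) ×ˢ (MMRisk.block r ⁻¹' A)) 1)
    (measurable_one.indicator hR2)
  refine Eq.trans this ?_
  calc _ = ∫⁻ x, (agg r ⁻¹' ({d} ×ˢ B)).indicator (fun _ => L d.1 (MMRisk.block r ⁻¹' A)) x ∂L i := by
        refine lintegral_congr fun x => ?_
        by_cases hx : agg r x ∈ ({d} ×ˢ B : Set (Site n))
        · have hd : (agg r x).1 = d := by simpa using hx.1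
          rw [indicator_of_mem (by exact hx), hd, ← lintegral_indicator_one (hb hA)]
          refine lintegral_congr fun y => ?_
          by_cases hy : y ∈ MMRisk.block r ⁻¹' A
          · rw [indicator_of_mem hy, indicator_of_mem (mk_mem_prod hx hy)]; rfl
          · rw [indicator_of_notMem hy, indicator_of_notMem (fun h => hy h.2)]
        · rw [indicator_of_notMem (by exact hx)]
          convert! lintegral_zero with y
          rw [indicator_of_notMem (fun h => hx h.1)]
    _ = _ := by
        rw [lintegral_indicator_const ((measurable_agg r) hR), mul_comm]

/-! ### Limits -/

/-- Probabilities of sets need not converge, but integrals of bounded continuous functions do, and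
products `f * g` of these determine a product measure. Marks are discrete, so the indicator `φ` of a
mark is continuous and can be carried along in the limit. -/
lemma Renewal.of_tendsto {Ω : Type*} [MeasurableSpace Ω] {P : Fin n → Measure Ω}
    [∀ i, IsProbabilityMeasure (P i)] {ξ : ℕ → Ω → ℕ → Site n} {η : Ω → ℕ → Site n}
    (hξ : ∀ l, Measurable (ξ l)) (hη : Measurable η)
    (h : ∀ l, Renewal fun i => (P i).map (ξ l))
    (hlim : ∀ ω k, Tendsto (fun l => ξ l ω k) atTop (𝓝 (η ω k))) :
    Renewal fun i => (P i).map η := by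
  have hprob : ∀ {ζ : Ω → ℕ → Site n}, Measurable ζ → ∀ i, IsProbabilityMeasure ((P i).map ζ) :=
    fun hζ i => Measure.isProbabilityMeasure_map hζ.aemeasurable
  have hlim' : ∀ ω, Tendsto (fun l => ξ l ω) atTop (𝓝 (η ω)) := fun ω =>
    tendsto_pi_nhds.2 (hlim ω)
  intro i d B A hB hA
  let φ : Site n → ℝ := fun s => if s.1 = d then 1 else 0
  have hφc : Continuous φ := by
    have : Continuous fun e : Fin n × ℕ => if e = d then (1 : ℝ) else 0 :=
      continuous_of_discreteTopology
    exact this.comp continuous_fst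
  have hφm : Measurable φ := hφc.measurable
  have hφ1 : ∀ s, ‖φ s‖ ≤ 1 := fun s => by
    simp only [φ]; split_ifs <;> simp
  have hE := measurableSet_firstSet d MeasurableSet.univ
  have hm0 : Measurable fun x : ℕ → Site n => (x 0).2 := by fun_prop
  have hmp : Measurable fun x : ℕ → Site n => ((x 0).2, shift x) := by fun_prop
  have rew : ∀ (ζ : Ω → ℕ → Site n), Measurable ζ → ∀ G : (ℕ → Site n) → ℝ, Measurable G →
      ∫ x in firstSet d univ, G x ∂((P i).map ζ) = ∫ ω, φ (ζ ω 0) * G (ζ ω) ∂P i := by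
    intro ζ hζ G hG
    rw [← integral_indicator hE, integral_map hζ.aemeasurable
      (hG.indicator hE).aestronglyMeasurable]
    refine integral_congr_ae (Eventually.of_forall fun ω => ?_)
    by_cases hx : (ζ ω 0).1 = d
    · simp [indicator, firstSet, φ, hx]
    · simp [indicator, firstSet, φ, hx]
  have prodform : ∀ l (f : BoundedContinuousFunction ℝ ℝ)
      (g : BoundedContinuousFunction (ℕ → Site n) ℝ),
      ∫ ω, φ (ξ l ω 0) * (f (ξ l ω 0).2 * g (shift (ξ l ω))) ∂P i =
        (∫ ω, φ (ξ l ω 0) * f (ξ l ω 0).2 ∂P i) * ∫ ω, g (ξ l ω) ∂P d.1 := by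
    intro l f g
    have := hprob (hξ l)
    have key : (((P i).map (ξ l)).restrict (firstSet d univ)).map (fun x => ((x 0).2, shift x)) =
        ((((P i).map (ξ l)).restrict (firstSet d univ)).map fun x => (x 0).2).prod
          ((P d.1).map (ξ l)) := by
      refine (Measure.prod_eq fun B A hB hA => ?_).symm
      rw [Measure.map_apply hmp (hB.prod hA), Measure.map_apply hm0 hB,
        Measure.restrict_apply (hmp (hB.prod hA)), Measure.restrict_apply (hm0 hB)]
      have e1 : (fun x : ℕ → Site n => ((x 0).2, shift x)) ⁻¹' B ×ˢ A ∩ firstSet d univ =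
          firstSet d B ∩ shift ⁻¹' A := by
        ext x; simp [firstSet]; tauto
      have e2 : (fun x : ℕ → Site n => (x 0).2) ⁻¹' B ∩ firstSet d univ = firstSet d B := by
        ext x; simp [firstSet]; tauto
      rw [e1, e2]
      exact h l i d B A hB hA
    have hf := f.continuous.measurable
    have hg := g.continuous.measurable
    rw [← rew (ξ l) (hξ l) (fun x => f (x 0).2 * g (shift x)) (by fun_prop),
      ← rew (ξ l) (hξ l) (fun x => f (x 0).2) (by fun_prop),
      ← integral_map (φ := fun x : ℕ → Site n => ((x 0).2, shift x)) hmp.aemeasurable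
        (f := fun p => f p.1 * g p.2)
        (by fun_prop : Measurable fun p : ℝ × (ℕ → Site n) => f p.1 * g p.2).aestronglyMeasurable,
      key, integral_prod_mul, integral_map hm0.aemeasurable hf.aestronglyMeasurable,
      integral_map (hξ l).aemeasurable hg.aestronglyMeasurable]
  have key : (((P i).map η).restrict (firstSet d univ)).map (fun x => ((x 0).2, shift x)) =
      ((((P i).map η).restrict (firstSet d univ)).map fun x => (x 0).2).prod
        ((P d.1).map η) := by
    have := hprob hη
    refine Measure.eq_prod_of_integral_mul_boundedContinuousFunction fun f g => ?_
    have hf := f.continuous.measurable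
    have hg := g.continuous.measurable
    rw [integral_map hmp.aemeasurable
        (by fun_prop : Measurable fun p : ℝ × (ℕ → Site n) => f p.1 * g p.2).aestronglyMeasurable,
      integral_map hm0.aemeasurable hf.aestronglyMeasurable,
      integral_map hη.aemeasurable hg.aestronglyMeasurable,
      rew η hη (fun x => f (x 0).2 * g (shift x)) (by fun_prop),
      rew η hη (fun x => f (x 0).2) (by fun_prop)]
    have hφf : ∀ s : Site n, ‖φ s * f s.2‖ ≤ ‖f‖ := fun s => by
      rw [norm_mul]
      exact (mul_le_mul (hφ1 s) (f.norm_coe_le_norm _) (norm_nonneg _) zero_le_one).trans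
        (one_mul _).le
    have c0 : Continuous fun x : ℕ → Site n => φ (x 0) * f (x 0).2 := by fun_prop
    have c1 : Continuous fun x : ℕ → Site n => φ (x 0) * (f (x 0).2 * g (shift x)) := by fun_prop
    have l1 : Tendsto (fun l => ∫ ω, φ (ξ l ω 0) * (f (ξ l ω 0).2 * g (shift (ξ l ω))) ∂P i) atTop
        (𝓝 (∫ ω, φ (η ω 0) * (f (η ω 0).2 * g (shift (η ω))) ∂P i)) := by
      refine tendsto_integral_of_dominated_convergence (fun _ => ‖f‖ * ‖g‖)
        (fun l => (c1.measurable.comp (hξ l)).aestronglyMeasurable) (integrable_const _) ?_ ?_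
      · refine fun l => Eventually.of_forall fun ω => ?_
        rw [← mul_assoc, norm_mul]
        exact mul_le_mul (hφf _) (g.norm_coe_le_norm _) (norm_nonneg _) (norm_nonneg _)
      · exact Eventually.of_forall fun ω => (c1.tendsto _).comp (hlim' ω)
    have l2 : Tendsto (fun l => ∫ ω, φ (ξ l ω 0) * f (ξ l ω 0).2 ∂P i) atTop
        (𝓝 (∫ ω, φ (η ω 0) * f (η ω 0).2 ∂P i)) := by
      refine tendsto_integral_of_dominated_convergence (fun _ => ‖f‖)
        (fun l => (c0.measurable.comp (hξ l)).aestronglyMeasurable) (integrable_const _) ?_ ?_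
      · exact fun l => Eventually.of_forall fun ω => hφf _
      · exact Eventually.of_forall fun ω => (c0.tendsto _).comp (hlim' ω)
    have l3 : Tendsto (fun l => ∫ ω, g (ξ l ω) ∂P d.1) atTop (𝓝 (∫ ω, g (η ω) ∂P d.1)) := by
      refine tendsto_integral_of_dominated_convergence (fun _ => ‖g‖)
        (fun l => (hg.comp (hξ l)).aestronglyMeasurable) (integrable_const _) ?_ ?_
      · exact fun l => Eventually.of_forall fun ω => g.norm_coe_le_norm _
      · exact Eventually.of_forall fun ω => (g.continuous.tendsto _).comp (hlim' ω)
    refine tendsto_nhds_unique l1 ?_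
    simp only [prodform]
    exact l2.mul l3
  have := hprob hη
  have e1 : (fun x : ℕ → Site n => ((x 0).2, shift x)) ⁻¹' B ×ˢ A ∩ firstSet d univ =
      firstSet d B ∩ shift ⁻¹' A := by
    ext x; simp [firstSet]; tauto
  have e2 : (fun x : ℕ → Site n => (x 0).2) ⁻¹' B ∩ firstSet d univ = firstSet d B := by
    ext x; simp [firstSet]; tauto
  have := congrArg (fun μ => μ (B ×ˢ A)) key
  simpa only [Measure.prod_prod, Measure.map_apply hmp (hB.prod hA), Measure.map_apply hm0 hB,
    Measure.restrict_apply (hmp (hB.prod hA)), Measure.restrict_apply (hm0 hB), e1, e2] using this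

end MMRisk

end

noncomputable section

namespace MMRisk

variable {n : ℕ}

/-! ### The strong law of large numbers for Markov additive sequences

The sequence is realised by drawing, at every visit to a state, a fresh entry of an independent
array. -/

/-- The numbers of earlier visits and the current state, when the `r`-th visit to `j` is followed
by the cell `u (r, j)`. -/
def urnState (u : ℕ × Fin n → Site n) (i : Fin n) : ℕ → (Fin n → ℕ) × Fin n
  | 0 => (0, i)
  | k + 1 =>
    let c := urnState u i k
    (Function.update c.1 c.2 (c.1 c.2 + 1), (u (c.1 c.2, c.2)).1.1)

/-- The cell sequence drawn from the array `u`. -/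
def urn (i : Fin n) (u : ℕ × Fin n → Site n) (k : ℕ) : Site n :=
  u ((urnState u i k).1 (urnState u i k).2, (urnState u i k).2)

/-- The numbers of visits to the states before cell `k`, for given marks. -/
def visits (i : Fin n) (d : ℕ → Fin n × ℕ) : ℕ → Fin n → ℕ
  | 0 => 0
  | k + 1 => Function.update (visits i d k) (startState i d k)
      (visits i d k (startState i d k) + 1)

/-- The array index used in cell `k`, for given marks. -/
def slot (i : Fin n) (d : ℕ → Fin n × ℕ) (k : ℕ) : ℕ × Fin n :=
  (visits i d k (startState i d k), startState i d k)

lemma visits_mono (i : Fin n) (d : ℕ → Fin n × ℕ) : Monotone (visits i d) := by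
  refine monotone_nat_of_le_succ fun k j => ?_
  rw [visits]
  by_cases h : j = startState i d k
  · subst h; simp
  · simp [h]

/-- Each visit raises the counter of its state, so no array entry is used twice. This is what makes
the entries along prescribed marks independent. -/
lemma slot_injective (i : Fin n) (d : ℕ → Fin n × ℕ) : Function.Injective (slot i d) := by
  have key : ∀ k k', k < k' → slot i d k ≠ slot i d k' := by
    intro k k' hk h
    have h2 : startState i d k = startState i d k' := congrArg Prod.snd h
    have h1 : visits i d k (startState i d k) = visits i d k' (startState i d k') :=
      congrArg Prod.fst h
    have e : visits i d (k + 1) (startState i d k) = visits i d k (startState i d k) + 1 := by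
      rw [visits, Function.update_self]
    have h3 : visits i d (k + 1) (startState i d k) ≤ visits i d k' (startState i d k) :=
      visits_mono i d (show k + 1 ≤ k' from hk) (startState i d k)
    rw [← h2] at h1
    omega
  intro k k' h
  rcases lt_trichotomy k k' with hk | hk | hk
  · exact absurd h (key _ _ hk)
  · exact hk
  · exact absurd h.symm (key _ _ hk)

/-- While the drawn marks follow `d`, the random array index is the deterministic `slot`. Here
agreement is read from the array, in `urnState_eq'` from the drawn sequence; the two directions of
`urn_mem_cyl_iff` need one each. -/
lemma urnState_eq (u : ℕ × Fin n → Site n) (i : Fin n) (d : ℕ → Fin n × ℕ) (k : ℕ)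
    (h : ∀ a < k, (u (slot i d a)).1 = d a) :
    urnState u i k = (visits i d k, startState i d k) := by
  induction k with
  | zero => rfl
  | succ k ih =>
    have := h k (by omega)
    simp only [slot] at this
    simp only [urnState, ih fun a ha => h a (by omega)]
    rw [this]
    rfl

lemma urnState_eq' (u : ℕ × Fin n → Site n) (i : Fin n) (d : ℕ → Fin n × ℕ) (k : ℕ)
    (h : ∀ a < k, (urn i u a).1 = d a) :
    urnState u i k = (visits i d k, startState i d k) := by
  induction k with
  | zero => rfl
  | succ k ih =>
    have h1 := ih fun a ha => h a (by omega)
    have := h k (by omega)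
    simp only [urn, h1] at this
    simp only [urnState, h1]
    rw [this]
    rfl

lemma urn_mem_cyl_iff (u : ℕ × Fin n → Site n) (i : Fin n) (m : ℕ) (d : ℕ → Fin n × ℕ)
    (B : ℕ → Set ℝ) : urn i u ∈ cyl m d B ↔
      ∀ k ∈ Finset.range m, u ∈ (fun u => u (slot i d k)) ⁻¹' ({d k} ×ˢ B k) := by
  constructor
  · intro h k hk
    have hk := Finset.mem_range.1 hk
    have := urnState_eq' u i d k fun a ha => (h a (ha.trans hk)).1
    have h2 := h k hk
    simp only [urn, this] at h2
    simpa [slot] using h2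
  · intro h k hk
    have := urnState_eq u i d k fun a ha => by
      have := h a (Finset.mem_range.2 (ha.trans hk))
      simpa using this.1
    have h2 := h k (Finset.mem_range.2 hk)
    simp only [urn, this]
    simpa [slot] using h2

lemma measurable_urnState (i : Fin n) (k : ℕ) :
    Measurable fun u : ℕ × Fin n → Site n => urnState u i k := by
  have hev : Measurable fun p : (ℕ × Fin n → Site n) × (ℕ × Fin n) => p.1 p.2 :=
    measurable_from_prod_countable_left fun a => measurable_pi_apply a
  induction k with
  | zero => exact measurable_const
  | succ k ih =>
    have h1 : Measurable fun c : (Fin n → ℕ) × Fin n =>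
      Function.update c.1 c.2 (c.1 c.2 + 1) := measurable_of_countable _
    have h2 : Measurable fun c : (Fin n → ℕ) × Fin n => (c.1 c.2, c.2) := measurable_of_countable _
    have h3 : Measurable fun u : ℕ × Fin n → Site n =>
        u ((urnState u i k).1 (urnState u i k).2, (urnState u i k).2) :=
      hev.comp (measurable_id.prodMk (h2.comp ih))
    exact (h1.comp ih).prodMk (measurable_fst.comp (measurable_fst.comp h3))

lemma measurable_urn (i : Fin n) : Measurable (urn (n := n) i) := by
  have hev : Measurable fun p : (ℕ × Fin n → Site n) × (ℕ × Fin n) => p.1 p.2 :=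
    measurable_from_prod_countable_left fun a => measurable_pi_apply a
  have h2 : Measurable fun c : (Fin n → ℕ) × Fin n => (c.1 c.2, c.2) := measurable_of_countable _
  exact measurable_pi_lambda _ fun k =>
    hev.comp (measurable_id.prodMk (h2.comp (measurable_urnState i k)))

lemma sum_urn (u : ℕ × Fin n → Site n) (i : Fin n) (m : ℕ) :
    ∑ k ∈ Finset.range m, (urn i u k).2 =
      ∑ j, ∑ r ∈ Finset.range ((urnState u i m).1 j), (u (r, j)).2 := by
  induction m with
  | zero => simp [urnState]
  | succ m ih =>
    rw [Finset.sum_range_succ, ih]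
    simp only [urnState, urn]
    set c := urnState u i m
    rw [← Finset.sum_erase_add _ _ (Finset.mem_univ c.2),
      ← Finset.sum_erase_add Finset.univ _ (Finset.mem_univ c.2), add_assoc]
    congr 1
    · refine Finset.sum_congr rfl fun j hj => ?_
      rw [Function.update_of_ne (Finset.ne_of_mem_erase hj)]
    · rw [Function.update_self, Finset.sum_range_succ]

lemma sum_urnState (u : ℕ × Fin n → Site n) (i : Fin n) (m : ℕ) :
    ∑ j, (urnState u i m).1 j = m := by
  induction m with
  | zero => simp [urnState]
  | succ m ih =>
    simp only [urnState]
    set c := urnState u i m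
    rw [← Finset.sum_erase_add _ _ (Finset.mem_univ c.2), Function.update_self]
    rw [← Finset.sum_erase_add _ _ (Finset.mem_univ c.2)] at ih
    have : ∑ j ∈ Finset.univ.erase c.2, Function.update c.1 c.2 (c.1 c.2 + 1) j =
        ∑ j ∈ Finset.univ.erase c.2, c.1 j := Finset.sum_congr rfl fun j hj => by
      rw [Function.update_of_ne (Finset.ne_of_mem_erase hj)]
    omega

variable {L : Fin n → Measure (ℕ → Site n)}

/-- The law of an array of independent cells, whose entry `(r, j)` has the law of the first cell
when starting in state `j`. -/
def arrayLaw (L : Fin n → Measure (ℕ → Site n)) : Measure (ℕ × Fin n → Site n) :=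
  Measure.infinitePi fun p : ℕ × Fin n => (L p.2).map fun x => x 0

/-- Prescribing marks turns a cylinder into conditions on distinct, fixed array entries;
independence then gives the product of `Renewal.productLaw`. Almost sure statements about the
sequence can thus be proved on an array of independent cells. -/
lemma Renewal.map_urn [∀ i, IsProbabilityMeasure (L i)] (h : Renewal L) (i : Fin n) :
    (arrayLaw L).map (urn i) = L i := by
  have hprob : ∀ p : ℕ × Fin n, IsProbabilityMeasure ((L p.2).map fun x => x 0) := fun p =>
    Measure.isProbabilityMeasure_map (measurable_pi_apply 0).aemeasurable
  have hind : iIndepFun (fun (p : ℕ × Fin n) (u : ℕ × Fin n → Site n) => u p) (arrayLaw L) :=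
    iIndepFun_infinitePi (X := fun _ ω => ω) fun _ => measurable_id
  have hprobA : IsProbabilityMeasure (arrayLaw L) := by unfold arrayLaw; infer_instance
  have : ∀ i, IsProbabilityMeasure ((arrayLaw L).map (urn i)) := fun i =>
    Measure.isProbabilityMeasure_map (measurable_urn i).aemeasurable
  have main : ∀ i m d B, (∀ k, MeasurableSet (B k)) → ((arrayLaw L).map (urn i)) (cyl m d B) =
      ∏ k ∈ Finset.range m, L (startState i d k) (firstSet (d k) (B k)) := by
    intro i m d B hB
    rw [Measure.map_apply (measurable_urn i) (measurableSet_cyl hB)]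
    have e : urn i ⁻¹' cyl m d B =
        ⋂ k ∈ Finset.range m, (fun u => u (slot i d k)) ⁻¹' ({d k} ×ˢ B k) := by
      ext u
      rw [mem_preimage, urn_mem_cyl_iff]
      simp
    rw [e, (iIndepFun_iff_measure_inter_preimage_eq_mul.1
      (hind.precomp (slot_injective i d))) (Finset.range m) (sets := fun k => {d k} ×ˢ B k)
      fun k _ => (measurableSet_singleton _).prod (hB k)]
    refine Finset.prod_congr rfl fun k _ => ?_
    have hR : MeasurableSet ({d k} ×ˢ B k) := (measurableSet_singleton _).prod (hB k)
    have hmap : (arrayLaw L).map (fun u => u (slot i d k)) =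
        (L (startState i d k)).map fun x => x 0 := Measure.infinitePi_map_eval _ _
    have hm : Measurable fun u : ℕ × Fin n → Site n => u (slot i d k) := measurable_pi_apply _
    have hm0 : Measurable fun x : ℕ → Site n => x 0 := measurable_pi_apply _
    rw [← Measure.map_apply hm hR, hmap, Measure.map_apply hm0 hR]
    congr 1
  refine ext_of_cyl fun m d B hB => ?_
  rw [main i m d B hB, h.productLaw i m d B hB]

/-- The bound must hold for every `m`, not just eventually: it is applied to the number of visits to
a state, which may stay bounded. The constant `K` absorbs the finitely many early terms. -/
lemma exists_linear_lower_bound {S : ℕ → ℝ} {g : ℝ} (hg : 0 < g)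
    (h : Tendsto (fun m : ℕ => S m / m) atTop (𝓝 g)) : ∃ K, ∀ m, g / 2 * m - K ≤ S m := by
  have h1 : ∀ᶠ m in atTop, g / 2 * m - S m ≤ 0 := by
    filter_upwards [h.eventually (lt_mem_nhds (half_lt_self hg)), eventually_gt_atTop 0]
      with m hm hm0
    have : (0 : ℝ) < m := by exact_mod_cast hm0
    have := (lt_div_iff₀ this).1 hm
    linarith
  obtain ⟨M, hM⟩ := eventually_atTop.1 h1
  obtain ⟨K, hK⟩ := ((Finset.range M).image fun m : ℕ => g / 2 * m - S m).bddAbove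
  refine ⟨max K 0, fun m => ?_⟩
  rcases lt_or_ge m M with hm | hm
  · have := hK (Finset.mem_coe.2 (Finset.mem_image_of_mem _ (Finset.mem_range.2 hm)))
    have := le_max_left K 0
    linarith
  · have := hM m hm
    have := le_max_right K 0
    linarith

/-- A Markov additive sequence whose increments have positive mean in every state drifts to
infinity. -/
theorem Renewal.tendsto_sum [∀ i, IsProbabilityMeasure (L i)] (h : Renewal L)
    (hmean : ∀ j, 0 < ∫ x, (x 0).2 ∂L j) (i : Fin n) :
    ∀ᵐ x ∂L i, Tendsto (fun m => ∑ k ∈ Finset.range m, (x k).2) atTop atTop := by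
  have hprob : ∀ p : ℕ × Fin n, IsProbabilityMeasure ((L p.2).map fun x => x 0) := fun p =>
    Measure.isProbabilityMeasure_map (measurable_pi_apply 0).aemeasurable
  have hind : iIndepFun (fun (p : ℕ × Fin n) (u : ℕ × Fin n → Site n) => u p) (arrayLaw L) :=
    iIndepFun_infinitePi (X := fun _ ω => ω) fun _ => measurable_id
  have hmap : ∀ p : ℕ × Fin n, (arrayLaw L).map (fun u => u p) = (L p.2).map fun x => x 0 :=
    fun p => Measure.infinitePi_map_eval _ _
  have hms : ∀ p : ℕ × Fin n, Measurable fun u : ℕ × Fin n → Site n => (u p).2 := fun p => by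
    fun_prop
  have hmean' : ∀ p : ℕ × Fin n, ∫ u, (u p).2 ∂arrayLaw L = ∫ x, (x 0).2 ∂L p.2 := by
    intro p
    rw [← integral_map (φ := fun u : ℕ × Fin n → Site n => u p) (f := fun s => s.2)
      (measurable_pi_apply p).aemeasurable measurable_snd.aestronglyMeasurable, hmap,
      integral_map (measurable_pi_apply 0).aemeasurable measurable_snd.aestronglyMeasurable]
  have slln : ∀ j : Fin n, ∀ᵐ u ∂arrayLaw L,
      Tendsto (fun m : ℕ => (∑ r ∈ Finset.range m, (u (r, j)).2 : ℝ) / (m : ℝ)) atTop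
        (𝓝 (∫ x, (x 0).2 ∂L j)) := by
    intro j
    rw [← hmean' (0, j)]
    -- A nonintegrable function has Bochner integral 0, so a positive mean forces integrability.
    have hint : Integrable (fun u : ℕ × Fin n → Site n => (u (0, j)).2) (arrayLaw L) := by
      by_contra hc
      have := hmean j
      rw [← hmean' (0, j), integral_undef hc] at this
      exact this.false
    refine strong_law_ae_real (μ := arrayLaw L)
      (fun (r : ℕ) (u : ℕ × Fin n → Site n) => (u (r, j)).2) hint ?_ fun r => ?_
    · intro r r' hr
      exact (hind.indepFun (show (r, j) ≠ (r', j) by simpa using hr)).comp measurable_snd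
        measurable_snd
    · refine ⟨(hms _).aemeasurable, (hms _).aemeasurable, ?_⟩
      have e : ∀ r : ℕ, (arrayLaw L).map (fun u => (u (r, j)).2) =
          ((L j).map fun x => x 0).map Prod.snd := fun r => by
        rw [← hmap (r, j), Measure.map_map measurable_snd (measurable_pi_apply _)]
        rfl
      rw [e, e]
  rw [← h.map_urn i]
  have hset : MeasurableSet {x : ℕ → Site n |
      Tendsto (fun m => ∑ k ∈ Finset.range m, (x k).2) atTop atTop} := by
    have : {x : ℕ → Site n | Tendsto (fun m => ∑ k ∈ Finset.range m, (x k).2) atTop atTop} =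
        ⋂ K : ℕ, ⋃ M : ℕ, ⋂ m : ℕ, ⋂ _ : M ≤ m, {x | (K : ℝ) ≤ ∑ k ∈ Finset.range m, (x k).2} := by
      ext x
      simp only [mem_ofPred_eq, mem_iInter, mem_iUnion, tendsto_atTop, eventually_atTop]
      refine ⟨fun hx K => hx K, fun hx b => ?_⟩
      obtain ⟨K, hK⟩ := exists_nat_ge b
      obtain ⟨M, hM⟩ := hx K
      exact ⟨M, fun m hm => hK.trans (hM m hm)⟩
    rw [this]
    refine MeasurableSet.iInter fun K => MeasurableSet.iUnion fun M => MeasurableSet.iInter fun m =>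
      MeasurableSet.iInter fun _ => measurableSet_le measurable_const ?_
    fun_prop
  rw [ae_map_iff (measurable_urn i).aemeasurable hset]
  filter_upwards [ae_all_iff.2 slln] with u hu
  -- The visit counts add up to `m`, so summing the row bounds gives linear growth with slope half
  -- the smallest mean.
  choose K hK using fun j => exists_linear_lower_bound (hmean j) (hu j)
  obtain ⟨j₀, -, hj₀⟩ := Finset.exists_min_image Finset.univ
    (fun j => ∫ x, (x 0).2 ∂L j) ⟨i, Finset.mem_univ i⟩
  set c := (∫ x, (x 0).2 ∂L j₀) / 2
  have hc : 0 < c := half_pos (hmean j₀)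
  refine tendsto_atTop_mono (f := fun m : ℕ => c * m - ∑ j, K j) (fun m => ?_) ?_
  · rw [sum_urn, sub_le_iff_le_add, ← Finset.sum_add_distrib]
    calc c * m = ∑ j, c * ((urnState u i m).1 j : ℝ) := by
          rw [← Finset.mul_sum, ← Nat.cast_sum, sum_urnState]
      _ ≤ _ := by
          refine Finset.sum_le_sum fun j _ => ?_
          have h1 := hK j ((urnState u i m).1 j)
          have h2 : c ≤ (∫ x, (x 0).2 ∂L j) / 2 := by
            have := hj₀ j (Finset.mem_univ j)
            simp only [c]; linarith
          have h3 := mul_le_mul_of_nonneg_right h2 (Nat.cast_nonneg (α := ℝ) ((urnState u i m).1 j))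
          linarith
  · exact tendsto_atTop_add_const_right _ _
      (tendsto_natCast_atTop_atTop.const_mul_atTop hc)

end MMRisk

end

/-! ### Deterministic path analysis: jumps, counts and epochs. -/

noncomputable section

namespace MMRisk

/-! ### Càdlàg step functions -/

section Paths

variable {S : Type*} [TopologicalSpace S] {f : ℝ≥0 → S}

lemma zero_notMem_jumpSet (f : ℝ≥0 → S) : 0 ∉ jumpSet f := fun h =>
  h (leftLim_eq_of_isBot isBot_bot)

lemma tendsto_leftLim_of_exists (hl : ∀ t, ∃ j, Tendsto f (𝓝[<] t) (𝓝 j)) (t : ℝ≥0) :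
    Tendsto f (𝓝[<] t) (𝓝 (Function.leftLim f t)) :=
  tendsto_leftLim_of_tendsto (hl t)

variable [DiscreteTopology S]

lemma notMem_jumpSet_of_eventually_eq {t : ℝ≥0} {c : S} (h : ∀ᶠ u in 𝓝 t, f u = c) :
    t ∉ jumpSet f := by
  have hc : ContinuousAt f t := by
    have : f =ᶠ[𝓝 t] fun _ => c := h
    exact this.continuousAt
  exact fun ht => ht hc.continuousWithinAt.leftLim_eq

/-- One-sided limits in a discrete space are eventually attained, so the path is locally constant on
a punctured neighbourhood of `t`. -/
lemma eventually_notMem_jumpSet (hr : ∀ t, ContinuousWithinAt f (Ici t) t)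
    (hl : ∀ t, ∃ j, Tendsto f (𝓝[<] t) (𝓝 j)) (t : ℝ≥0) : ∀ᶠ u in 𝓝[≠] t, u ∉ jumpSet f := by
  rw [← nhdsLT_sup_nhdsGT, eventually_sup]
  constructor
  · obtain ⟨j, hj⟩ := hl t
    have h1 : ∀ᶠ u in 𝓝[<] t, f u = j := hj.eventually (p := fun v => v = j) (by simp)
    filter_upwards [eventually_eventually_nhdsWithin.2 h1, self_mem_nhdsWithin] with u hu hut
    rw [isOpen_Iio.nhdsWithin_eq hut] at hu
    exact notMem_jumpSet_of_eventually_eq hu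
  · have h1 : ∀ᶠ u in 𝓝[>] t, f u = f t :=
      ((hr t).mono Ioi_subset_Ici_self).eventually (p := fun v => v = f t) (by simp)
    filter_upwards [eventually_eventually_nhdsWithin.2 h1, self_mem_nhdsWithin] with u hu hut
    rw [isOpen_Ioi.nhdsWithin_eq hut] at hu
    exact notMem_jumpSet_of_eventually_eq hu

lemma finite_jumpSet (hr : ∀ t, ContinuousWithinAt f (Ici t) t)
    (hl : ∀ t, ∃ j, Tendsto f (𝓝[<] t) (𝓝 j)) (T : ℝ≥0) : (jumpSet f ∩ Iic T).Finite := by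
  by_contra hinf
  have hK : IsCompact (Icc 0 T) := isCompact_Icc
  obtain ⟨x, -, hx⟩ := Set.Infinite.exists_accPt_of_subset_isCompact (K := Icc 0 T) hinf hK
    (fun u hu => ⟨zero_le, hu.2⟩)
  rw [accPt_iff_frequently_nhdsNE] at hx
  exact hx ((eventually_notMem_jumpSet hr hl x).mono fun u hu h => hu h.1)

/-- Without jumps the path is continuous on an interval, which is connected, and takes values in a
discrete space. -/
lemma eq_of_no_jump (hr : ∀ t, ContinuousWithinAt f (Ici t) t)
    (hl : ∀ t, ∃ j, Tendsto f (𝓝[<] t) (𝓝 j)) {s t : ℝ≥0} (hst : s ≤ t)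
    (h : ∀ u ∈ Ioc s t, u ∉ jumpSet f) : f t = f s := by
  have hc : ContinuousOn f (Icc s t) := by
    intro u hu
    rcases eq_or_lt_of_le hu.1 with rfl | hsu
    · exact (hr s).mono fun v hv => hv.1
    · have h1 : Function.leftLim f u = f u := not_not.1 (h u ⟨hsu, hu.2⟩)
      have h2 := tendsto_leftLim_of_exists hl u
      rw [h1] at h2
      have : ContinuousAt f u := continuousAt_iff_continuous_left'_right'.2 ⟨h2, (hr u).mono Ioi_subset_Ici_self⟩
      exact this.continuousWithinAt
  exact isPreconnected_Icc.constant hc ⟨hst, le_rfl⟩ ⟨le_rfl, hst⟩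

lemma leftLim_eq_of_no_jump (hr : ∀ t, ContinuousWithinAt f (Ici t) t)
    (hl : ∀ t, ∃ j, Tendsto f (𝓝[<] t) (𝓝 j)) {s t : ℝ≥0} (hst : s < t)
    (h : ∀ u ∈ Ioo s t, u ∉ jumpSet f) : Function.leftLim f t = f s := by
  have h1 : ∀ᶠ u in 𝓝[<] t, f u = f s := by
    filter_upwards [Ioo_mem_nhdsLT hst] with u hu
    exact eq_of_no_jump hr hl hu.1.le fun v hv => h v ⟨hv.1, hv.2.trans_lt hu.2⟩
  have : (𝓝[<] t).NeBot := nhdsLT_neBot_of_exists_lt ⟨s, hst⟩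
  exact leftLim_eq_of_tendsto (tendsto_const_nhds.congr' (h1.mono fun u hu => hu.symm))

lemma values_of_single_jump (hr : ∀ t, ContinuousWithinAt f (Ici t) t)
    (hl : ∀ t, ∃ j, Tendsto f (𝓝[<] t) (𝓝 j)) {s t τ : ℝ≥0}
    (h : jumpSet f ∩ Ioc s t = {τ}) :
    Function.leftLim f τ = f s ∧ f τ = f t ∧ f s ≠ f t := by
  have hτ : τ ∈ jumpSet f ∩ Ioc s t := h ▸ mem_singleton τ
  have hu : ∀ u ∈ Ioc s t, u ∈ jumpSet f → u = τ := fun u hu hj =>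
    mem_singleton_iff.1 (h ▸ (⟨hj, hu⟩ : u ∈ jumpSet f ∩ Ioc s t))
  have h1 : Function.leftLim f τ = f s :=
    leftLim_eq_of_no_jump hr hl hτ.2.1 fun u hu' hj =>
      hu'.2.ne (hu u ⟨hu'.1, hu'.2.le.trans hτ.2.2⟩ hj)
  have h2 : f t = f τ :=
    eq_of_no_jump hr hl hτ.2.2 fun u hu' hj => hu'.1.ne' (hu u ⟨hτ.2.1.trans hu'.1, hu'.2⟩ hj)
  exact ⟨h1, h2.symm, by rw [← h1, h2]; exact hτ.1⟩

end Paths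

/-! ### Epochs of locally finite sets -/

section Epochs

variable {D : Set ℝ≥0}

/-- The number of elements of `D` up to time `t`. -/
def cnt (D : Set ℝ≥0) (t : ℝ≥0) : ℕ := (D ∩ Iic t).ncard

lemma cnt_mono (hfin : ∀ t, (D ∩ Iic t).Finite) : Monotone (cnt D) := fun _ t h =>
  ncard_le_ncard (inter_subset_inter_right _ (Iic_subset_Iic.2 h)) (hfin t)

lemma cnt_zero (h0 : 0 ∉ D) : cnt D 0 = 0 := by
  have : D ∩ Iic 0 = ∅ := by
    ext x
    simp only [mem_inter_iff, mem_Iic, nonpos_iff_eq_zero, mem_empty_iff_false, iff_false]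
    rintro ⟨h, rfl⟩
    exact h0 h
  rw [cnt, this, ncard_empty]

lemma cnt_eq_of_empty {s t : ℝ≥0} (hst : s ≤ t) (h : D ∩ Ioc s t = ∅) : cnt D t = cnt D s := by
  unfold cnt
  rw [← Iic_union_Ioc_eq_Iic hst, inter_union_distrib_left, h, union_empty]

lemma cnt_eq_of_singleton (hfin : ∀ t, (D ∩ Iic t).Finite) {s t τ : ℝ≥0}
    (h : D ∩ Ioc s t = {τ}) : cnt D t = cnt D s + 1 := by
  have hτ : τ ∈ D ∩ Ioc s t := h ▸ mem_singleton τ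
  unfold cnt
  rw [← Iic_union_Ioc_eq_Iic (hτ.2.1.le.trans hτ.2.2), inter_union_distrib_left, h, union_singleton,
    ncard_insert_of_notMem (fun hm => not_le_of_gt hτ.2.1 hm.2) (hfin s)]

lemma cnt_lt_cnt (hfin : ∀ t, (D ∩ Iic t).Finite) {s t : ℝ≥0} (hst : s < t) (ht : t ∈ D) :
    cnt D s < cnt D t :=
  ncard_lt_ncard ⟨inter_subset_inter_right _ (Iic_subset_Iic.2 hst.le),
    fun h => not_le_of_gt hst (h ⟨ht, self_mem_Iic⟩).2⟩ (hfin t)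

/-- Between two times with different counts there is a last element. -/
lemma exists_last (hfin : ∀ t, (D ∩ Iic t).Finite) {t : ℝ≥0} (h : cnt D t ≠ 0) :
    ∃ τ ∈ D, τ ≤ t ∧ D ∩ Ioc τ t = ∅ := by
  have hne : (D ∩ Iic t).Nonempty := by
    rw [nonempty_iff_ne_empty]
    intro he
    exact h (by rw [cnt, he, ncard_empty])
  obtain ⟨τ, hτ⟩ := (hfin t).exists_maximal hne
  refine ⟨τ, hτ.1.1, hτ.1.2, ?_⟩
  ext u
  simp only [mem_inter_iff, mem_Ioc, mem_empty_iff_false, iff_false]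
  rintro ⟨hu, h1, h2⟩
  exact not_lt_of_ge (hτ.2 ⟨hu, h2⟩ h1.le) h1

/-- The set of elements of `D` before an element `τ` has one fewer element. -/
lemma exists_before (h0 : 0 ∉ D) (hfin : ∀ t, (D ∩ Iic t).Finite) {τ : ℝ≥0} (hτ : τ ∈ D) :
    ∃ s < τ, D ∩ Ioc s τ = {τ} := by
  have hpos : 0 < τ := by
    rcases eq_or_lt_of_le (zero_le (a := τ)) with h | h
    · exact absurd (h ▸ hτ) h0
    · exact h
  have hf : (D ∩ Iio τ ∪ {0}).Finite :=
    ((hfin τ).subset (inter_subset_inter_right _ Iio_subset_Iic_self)).union (finite_singleton 0)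
  obtain ⟨s, hs⟩ := hf.exists_maximal ⟨0, Or.inr rfl⟩
  have hsτ : s < τ := by
    rcases hs.1 with h | h
    · exact h.2
    · rw [mem_singleton_iff.1 h]; exact hpos
  refine ⟨s, hsτ, ?_⟩
  ext u
  simp only [mem_inter_iff, mem_Ioc, mem_singleton_iff]
  constructor
  · rintro ⟨hu, h1, h2⟩
    by_contra hne
    exact not_lt_of_ge (hs.2 (Or.inl ⟨hu, lt_of_le_of_ne h2 hne⟩) h1.le) h1
  · rintro rfl
    exact ⟨hτ, hsτ, le_rfl⟩

lemma exists_epoch_eq (hfin : ∀ t, (D ∩ Iic t).Finite) {k : ℕ} {t : ℝ≥0}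
    (h : epoch D (k + 1) ≤ t) : ∃ τ ∈ D, epoch D (k + 1) = τ ∧ epoch D k < τ := by
  have hlt : epoch D (k + 1) < ((t + 1 : ℝ≥0) : ℝ≥0∞) :=
    h.trans_lt (by exact_mod_cast lt_add_one t)
  have hne : (D ∩ Iic (t + 1) ∩ {u : ℝ≥0 | epoch D k < u}).Nonempty := by
    rw [epoch] at hlt
    simp only [iInf_lt_iff] at hlt
    obtain ⟨u, hu, h1, h2⟩ := hlt
    exact ⟨u, ⟨hu, by exact_mod_cast h2.le⟩, h1⟩
  obtain ⟨τ, hτ⟩ := ((hfin (t + 1)).inter_of_left _).exists_minimal hne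
  refine ⟨τ, hτ.1.1.1, le_antisymm ?_ ?_, hτ.1.2⟩
  · rw [epoch]
    exact iInf₂_le_of_le τ hτ.1.1.1 (iInf_le_of_le hτ.1.2 le_rfl)
  · rw [epoch]
    refine le_iInf₂ fun u hu => le_iInf fun h1 => ?_
    rcases le_or_gt u (t + 1) with h2 | h2
    · rcases le_total u τ with h3 | h3
      · exact_mod_cast hτ.2 ⟨⟨hu, h2⟩, h1⟩ h3
      · exact_mod_cast h3
    · exact_mod_cast (mem_Iic.1 hτ.1.1.2).trans h2.le

/-- Epochs and counts are inverse to each other in the Galois sense; this turns statements about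
epochs into statements about `cnt`. -/
lemma epoch_le_iff (h0 : 0 ∉ D) (hfin : ∀ t, (D ∩ Iic t).Finite) (k : ℕ) (t : ℝ≥0) :
    epoch D k ≤ t ↔ k ≤ cnt D t := by
  induction k generalizing t with
  | zero => simp [epoch]
  | succ k ih =>
    constructor
    · intro h
      obtain ⟨τ, hτ, he, hlt⟩ := exists_epoch_eq hfin h
      have hτt : τ ≤ t := by rw [he] at h; exact_mod_cast h
      obtain ⟨e, hee⟩ : ∃ e : ℝ≥0, epoch D k = e :=
        ⟨(epoch D k).toNNReal, (ENNReal.coe_toNNReal hlt.ne_top).symm⟩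
      have h1 : k ≤ cnt D e := (ih e).1 hee.le
      have h2 : e < τ := by rw [hee] at hlt; exact_mod_cast hlt
      have := cnt_lt_cnt hfin h2 hτ
      have := cnt_mono hfin hτt
      omega
    · intro h
      by_contra hc
      obtain ⟨τ, hτ, hτt, hlast⟩ := exists_last hfin (t := t) (by omega)
      obtain ⟨s, hs, hsing⟩ := exists_before h0 hfin hτ
      have c1 := cnt_eq_of_empty hτt hlast
      have c2 := cnt_eq_of_singleton hfin hsing
      have h1 : epoch D k ≤ s := (ih s).2 (by omega)
      refine hc (le_trans ?_ (ENNReal.coe_le_coe.2 hτt))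
      rw [epoch]
      exact iInf₂_le_of_le τ hτ (iInf_le_of_le (h1.trans_lt (by exact_mod_cast hs)) le_rfl)

lemma epoch_cnt_of_singleton (h0 : 0 ∉ D) (hfin : ∀ t, (D ∩ Iic t).Finite) {s t τ : ℝ≥0}
    (h : D ∩ Ioc s t = {τ}) : epoch D (cnt D t) = τ := by
  have hτ : τ ∈ D ∩ Ioc s t := h ▸ mem_singleton τ
  have hsing : D ∩ Ioc s τ = {τ} := by
    refine subset_antisymm ?_ (singleton_subset_iff.2 ⟨hτ.1, hτ.2.1, le_rfl⟩)
    rw [← h]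
    exact inter_subset_inter_right _ (Ioc_subset_Ioc_right hτ.2.2)
  have c1 := cnt_eq_of_singleton hfin h
  have c2 := cnt_eq_of_singleton hfin hsing
  have hle : epoch D (cnt D t) ≤ τ := (epoch_le_iff h0 hfin _ _).2 (by omega)
  obtain ⟨e, hee⟩ : ∃ e : ℝ≥0, epoch D (cnt D t) = e :=
    ⟨(epoch D (cnt D t)).toNNReal, (ENNReal.coe_toNNReal (hle.trans_lt ENNReal.coe_lt_top).ne).symm⟩
  rw [hee] at hle ⊢
  have hle' : e ≤ τ := by exact_mod_cast hle
  have h1 : cnt D t ≤ cnt D e := (epoch_le_iff h0 hfin _ _).1 hee.le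
  rcases eq_or_lt_of_le hle' with rfl | hlt
  · rfl
  · exfalso
    have : cnt D e ≤ cnt D s := by
      refine ncard_le_ncard (fun u hu => ⟨hu.1, ?_⟩) (hfin s)
      by_contra hus
      have : u ∈ D ∩ Ioc s τ := ⟨hu.1, not_le.1 hus, hu.2.trans hlt.le⟩
      rw [hsing] at this
      exact not_le_of_gt hlt (mem_singleton_iff.1 this ▸ hu.2)
    omega

/-- The finitely many points up to `T` have positive gaps, which the mesh eventually undercuts. -/
lemma eventually_subsingleton_cells (hfin : ∀ t, (D ∩ Iic t).Finite) {h : ℕ → ℝ≥0}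
    (hh : Tendsto h atTop (𝓝 0)) (T : ℝ≥0) :
    ∀ᶠ l in atTop, ∀ s t, t ≤ T → t ≤ s + h l → (D ∩ Ioc s t).Subsingleton := by
  have hF := (hfin T).prod (hfin T)
  have : ∀ᶠ l in atTop, ∀ p ∈ (D ∩ Iic T) ×ˢ (D ∩ Iic T), p.1 < p.2 → h l < p.2 - p.1 := by
    rw [eventually_all_finite hF]
    intro p _
    by_cases hp : p.1 < p.2
    · filter_upwards [hh.eventually (gt_mem_nhds (tsub_pos_of_lt hp))] with l hl _ using hl
    · exact Eventually.of_forall fun l h => absurd h hp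
  filter_upwards [this] with l hl s t htT hts
  have key : ∀ u ∈ D ∩ Ioc s t, ∀ v ∈ D ∩ Ioc s t, ¬ u < v := by
    intro u hu v hv huv
    have h1 := hl (u, v) ⟨⟨hu.1, hu.2.2.trans htT⟩, ⟨hv.1, hv.2.2.trans htT⟩⟩ huv
    have h2 : v ≤ u + h l := (hv.2.2.trans hts).trans (by gcongr; exact hu.2.1.le)
    exact absurd h1 (not_lt.2 (tsub_le_iff_left.2 h2))
  intro u hu v hv
  exact le_antisymm (not_lt.1 (key v hv u hu)) (not_lt.1 (key u hu v hv))

end Epochs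

/-- A counting function with unit jumps counts its jumps. -/
lemma counting_eq_cnt {f : ℝ≥0 → ℕ} (hr : ∀ t, ContinuousWithinAt f (Ici t) t)
    (hmono : Monotone f) (hl : ∀ t, ∃ j, Tendsto f (𝓝[<] t) (𝓝 j)) (h0 : f 0 = 0)
    (hu : ∀ t, f t ≤ Function.leftLim f t + 1) (t : ℝ≥0) : f t = cnt (jumpSet f) t := by
  have hfin := finite_jumpSet hr hl
  have hz := zero_notMem_jumpSet f
  induction hk : cnt (jumpSet f) t generalizing t with
  | zero =>
    rw [← h0]
    refine eq_of_no_jump hr hl zero_le fun u hu' hj => ?_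
    have he : jumpSet f ∩ Iic t = ∅ := (ncard_eq_zero (hfin t)).1 hk
    exact notMem_empty u (he ▸ ⟨hj, hu'.2⟩)
  | succ k ih =>
    obtain ⟨τ, hτ, hτt, hlast⟩ := exists_last hfin (t := t) (by omega)
    obtain ⟨s, hs, hsing⟩ := exists_before hz hfin hτ
    have c1 := cnt_eq_of_empty hτt hlast
    have c2 := cnt_eq_of_singleton hfin hsing
    have h1 : f t = f τ := eq_of_no_jump hr hl hτt fun u hu' hj =>
      notMem_empty u (hlast ▸ ⟨hj, hu'⟩)
    obtain ⟨h2, -, h3⟩ := values_of_single_jump hr hl hsing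
    have h4 := ih s (by omega)
    have h5 := hu τ
    have h6 : f s ≤ f τ := hmono hs.le
    rw [h2] at h5
    omega

lemma exists_tendsto_left_of_monotone {f : ℝ≥0 → ℕ} (hmono : Monotone f) (t : ℝ≥0) :
    ∃ j, Tendsto f (𝓝[<] t) (𝓝 j) :=
  ⟨_, hmono.tendsto_leftLim t⟩

end MMRisk

end

/-! ### Path decomposition and convergence of the grid cells. -/

noncomputable section

namespace MMRisk

/-! ### Riemann sums along right-continuous step functions -/

lemma tendsto_mesh (H : ℝ≥0) : Tendsto (fun l : ℕ => H / ((l : ℝ≥0) + 1)) atTop (𝓝 0) := by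
  rw [← NNReal.tendsto_coe]
  push_cast
  exact tendsto_const_nhds.div_atTop
    (tendsto_atTop_add_const_right _ _ (tendsto_natCast_atTop_atTop (R := ℝ)))

/-- The times `k H + (a + 1) H / (l + 1)` of a grid that divides `[k H, (k + 1) H]`. -/
lemma tendsto_grid_ceil {H : ℝ≥0} (hH : 0 < H) (u : ℝ) (hu : 0 ≤ u) :
    Tendsto (fun l : ℕ => (⌈u / (H / (l + 1) : ℝ≥0)⌉₊ : ℝ≥0) * (H / (l + 1))) atTop
      (𝓝[≥] u.toNNReal) := by
  have hpos : ∀ l : ℕ, (0 : ℝ) < (H / (l + 1) : ℝ≥0) := fun l => by positivity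
  rw [tendsto_nhdsWithin_iff]
  have hlow : ∀ l : ℕ, u.toNNReal ≤ (⌈u / (H / (l + 1) : ℝ≥0)⌉₊ : ℝ≥0) * (H / (l + 1)) := by
    intro l
    rw [Real.toNNReal_le_iff_le_coe]
    have := (div_le_iff₀ (hpos l)).1 (Nat.le_ceil (u / (H / (l + 1) : ℝ≥0)))
    simpa using this
  refine ⟨?_, Eventually.of_forall hlow⟩
  have hup : ∀ l : ℕ, (⌈u / (H / (l + 1) : ℝ≥0)⌉₊ : ℝ≥0) * (H / (l + 1)) ≤
      u.toNNReal + H / (l + 1) := by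
    intro l
    rw [← NNReal.coe_le_coe]
    have h1 := (Nat.ceil_lt_add_one (div_nonneg hu (hpos l).le)).le
    have h2 := mul_le_mul_of_nonneg_right h1 (hpos l).le
    rw [add_mul, div_mul_cancel₀ _ (hpos l).ne', one_mul] at h2
    push_cast at h2 ⊢
    rwa [Real.coe_toNNReal u hu]
  refine tendsto_of_tendsto_of_tendsto_of_le_of_le tendsto_const_nhds ?_ hlow hup
  have := tendsto_mesh H
  simpa using tendsto_const_nhds.add this

/-- The sum is the integral of the step function sampling the path at the next grid point to the
right. Right-continuity makes the samples converge at every time, and `g` is bounded because `S` is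
finite, so dominated convergence applies. -/
lemma tendsto_riemann_sum {S : Type*} [Finite S] [TopologicalSpace S] [DiscreteTopology S]
    {f : ℝ≥0 → S} (hr : ∀ t, ContinuousWithinAt f (Ici t) t) (g : S → ℝ) {H : ℝ≥0} (hH : 0 < H)
    (k : ℕ) :
    Tendsto (fun l : ℕ => ∑ a ∈ Finset.range (l + 1),
        ((H / (l + 1) : ℝ≥0) : ℝ) * g (f (((k * (l + 1) + a + 1 : ℕ) : ℝ≥0) * (H / (l + 1)))))
      atTop (𝓝 (∫ u in ((k * H : ℝ≥0) : ℝ)..(((k + 1 : ℕ) * H : ℝ≥0) : ℝ), g (f u.toNNReal))) := by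
  have hpos : ∀ l : ℕ, (0 : ℝ) < (H / (l + 1) : ℝ≥0) := fun l => by positivity
  let F : ℕ → ℝ → ℝ := fun l u => g (f ((⌈u / (H / (l + 1) : ℝ≥0)⌉₊ : ℝ≥0) * (H / (l + 1))))
  have hmeas : ∀ l, Measurable (F l) := by
    intro l
    have h1 : Measurable fun q : ℕ => g (f ((q : ℝ≥0) * (H / (l + 1)))) := measurable_of_countable _
    exact h1.comp (Nat.measurable_ceil.comp (measurable_id.div_const _))
  obtain ⟨C, hC⟩ : ∃ C, ∀ s, ‖g s‖ ≤ C := by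
    obtain ⟨C, hC⟩ := (Set.finite_range fun s => ‖g s‖).bddAbove
    exact ⟨C, fun s => hC ⟨s, rfl⟩⟩
  have hint : ∀ l a b, IntervalIntegrable (F l) volume a b := fun l a b =>
    intervalIntegrable_const (c := C) |>.mono_fun (hmeas l).aestronglyMeasurable
      (Eventually.of_forall fun u => (hC _).trans (le_abs_self C))
  have hsum : ∀ l : ℕ, ∑ a ∈ Finset.range (l + 1),
      ((H / (l + 1) : ℝ≥0) : ℝ) * g (f (((k * (l + 1) + a + 1 : ℕ) : ℝ≥0) * (H / (l + 1)))) =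
      ∫ u in ((k * H : ℝ≥0) : ℝ)..(((k + 1 : ℕ) * H : ℝ≥0) : ℝ), F l u := by
    intro l
    have hl : ((l : ℝ) + 1) ≠ 0 := by positivity
    have := intervalIntegral.sum_integral_adjacent_intervals (μ := volume) (f := F l) (n := l + 1)
      (a := fun a : ℕ => ((k * (l + 1) + a : ℕ) : ℝ) * (H / (l + 1) : ℝ≥0)) fun a _ => hint l _ _
    have e0 : ((k * (l + 1) + 0 : ℕ) : ℝ) * (H / (l + 1) : ℝ≥0) = ((k * H : ℝ≥0) : ℝ) := by
      push_cast; field_simp; ring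
    have e1 : ((k * (l + 1) + (l + 1) : ℕ) : ℝ) * (H / (l + 1) : ℝ≥0) =
        (((k + 1 : ℕ) * H : ℝ≥0) : ℝ) := by
      push_cast; field_simp
    simp only [e0, e1] at this
    rw [← this]
    refine Finset.sum_congr rfl fun a _ => ?_
    set b := k * (l + 1) + a
    have hb : (b : ℝ) * (H / (l + 1) : ℝ≥0) ≤ ((b + 1 : ℕ) : ℝ) * (H / (l + 1) : ℝ≥0) := by
      gcongr; omega
    have hcongr : ∫ u in ((b : ℕ) : ℝ) * (H / (l + 1) : ℝ≥0)..((b + 1 : ℕ) : ℝ) * (H / (l + 1) : ℝ≥0),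
        F l u = ∫ u in ((b : ℕ) : ℝ) * (H / (l + 1) : ℝ≥0)..((b + 1 : ℕ) : ℝ) * (H / (l + 1) : ℝ≥0),
        g (f (((b + 1 : ℕ) : ℝ≥0) * (H / (l + 1)))) := by
      refine intervalIntegral.integral_congr_ae (Eventually.of_forall fun u hu => ?_)
      rw [uIoc_of_le hb] at hu
      have : ⌈u / (H / (l + 1) : ℝ≥0)⌉₊ = b + 1 := by
        rw [Nat.ceil_eq_iff (by omega)]
        constructor
        · rw [lt_div_iff₀ (hpos l)]; simpa using hu.1
        · rw [div_le_iff₀ (hpos l)]; exact hu.2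
      simp only [F, this]
    have hlen : ((b + 1 : ℕ) : ℝ) * (H / (l + 1) : ℝ≥0) - (b : ℝ) * (H / (l + 1) : ℝ≥0) =
        (H / (l + 1) : ℝ≥0) := by push_cast; ring
    change _ = ∫ u in ((b : ℕ) : ℝ) * (H / (l + 1) : ℝ≥0)..((b + 1 : ℕ) : ℝ) * (H / (l + 1) : ℝ≥0),
        F l u
    rw [hcongr, intervalIntegral.integral_const, hlen, smul_eq_mul]
  simp only [hsum]
  refine intervalIntegral.tendsto_integral_filter_of_dominated_convergence (fun _ => C)
    (Eventually.of_forall fun l => (hmeas l).aestronglyMeasurable)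
    (Eventually.of_forall fun l => Eventually.of_forall fun u _ => hC _)
    intervalIntegrable_const (Eventually.of_forall fun u hu => ?_)
  have hu0 : 0 ≤ u := by
    rw [uIoc_of_le (by push_cast; gcongr; linarith)] at hu
    exact le_trans (by positivity) hu.1.le
  have h1 : Tendsto (fun l : ℕ => f ((⌈u / (H / (l + 1) : ℝ≥0)⌉₊ : ℝ≥0) * (H / (l + 1)))) atTop
      (𝓝 (f u.toNNReal)) := (hr _).tendsto.comp (tendsto_grid_ceil hH u hu0)
  exact (continuous_of_discreteTopology (f := g)).continuousAt.tendsto.comp h1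

namespace Model

variable {n : ℕ} {θ : Params n} {Ω : Type*} [MeasurableSpace Ω] (R : Model θ Ω)

/-! ### The paths of the risk process -/

/-- The sum of the claims up to time `t`. -/
def claimSum (t : ℝ≥0) (ω : Ω) : ℝ :=
  ∑ k ∈ Finset.Icc 1 (R.N t ω), R.C k (R.J (R.arrivalEpoch k ω).toNNReal ω) ω
    + ∑ k ∈ Finset.Icc 1 (R.envCount t ω),
        R.D k (Function.leftLim (fun s => R.J s ω) (R.envEpoch k ω).toNNReal)
          (R.J (R.envEpoch k ω).toNNReal ω) ω

lemma X_eq (x : ℝ) (t : ℝ≥0) (ω : Ω) : R.X x t ω =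
    x + (∫ u in (0 : ℝ)..(t : ℝ), θ.p (R.J u.toNNReal ω)) - R.claimSum t ω := by
  rw [X, claimSum]; ring

/-- The times at which a claim arrives or the environment jumps. -/
def jumps (ω : Ω) : Set ℝ≥0 := (jumpSet fun t => R.N t ω) ∪ (jumpSet fun t => R.J t ω)

lemma finite_jumpSet_J (ω : Ω) (T : ℝ≥0) : ((jumpSet fun t => R.J t ω) ∩ Iic T).Finite :=
  finite_jumpSet (R.chain.rightCont ω) (R.chain.leftLimit ω) T

lemma finite_jumpSet_N (ω : Ω) (T : ℝ≥0) : ((jumpSet fun t => R.N t ω) ∩ Iic T).Finite :=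
  finite_jumpSet (R.arrivals.rightCont ω) (exists_tendsto_left_of_monotone (R.arrivals.mono ω)) T

lemma finite_jumps (ω : Ω) (T : ℝ≥0) : (R.jumps ω ∩ Iic T).Finite := by
  rw [jumps, union_inter_distrib_right]
  exact (R.finite_jumpSet_N ω T).union (R.finite_jumpSet_J ω T)

lemma zero_notMem_jumps (ω : Ω) : 0 ∉ R.jumps ω := by
  rintro (h | h)
  · exact zero_notMem_jumpSet _ h
  · exact zero_notMem_jumpSet _ h

lemma N_eq_cnt (t : ℝ≥0) (ω : Ω) : R.N t ω = cnt (jumpSet fun t => R.N t ω) t :=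
  counting_eq_cnt (R.arrivals.rightCont ω) (R.arrivals.mono ω)
    (exists_tendsto_left_of_monotone (R.arrivals.mono ω)) (R.arrivals.zero ω)
    (R.arrivals.unitJumps ω) t

lemma envCount_eq_cnt (t : ℝ≥0) (ω : Ω) : R.envCount t ω = cnt (jumpSet fun t => R.J t ω) t := rfl

lemma envCount_mono (ω : Ω) : Monotone fun t => R.envCount t ω :=
  cnt_mono (R.finite_jumpSet_J ω)

/-- The claims in a time interval `(s, t]` with at most one event, if the transition claim is the
`k`-th one. -/
def cellClaims (k : ℕ) (s t : ℝ≥0) (ω : Ω) : ℝ :=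
  ∑ q ∈ Finset.Ioc (R.N s ω) (R.N t ω), R.C q (R.J t ω) ω +
    if R.J s ω = R.J t ω then 0 else R.D k (R.J s ω) (R.J t ω) ω

/-- The number of transitions of the environment in a time interval with at most one event. -/
def cellMoves (s t : ℝ≥0) (ω : Ω) : ℕ := if R.J s ω = R.J t ω then 0 else 1

variable {R}

lemma J_eq_of_empty {ω : Ω} {s t : ℝ≥0} (hst : s ≤ t)
    (h : (jumpSet fun t => R.J t ω) ∩ Ioc s t = ∅) : R.J t ω = R.J s ω :=
  eq_of_no_jump (R.chain.rightCont ω) (R.chain.leftLimit ω) hst fun u hu hj =>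
    notMem_empty u (h ▸ ⟨hj, hu⟩)

lemma eq_empty_or_singleton {S : Type*} {A B : Set S} (hB : B.Subsingleton) (hA : A ⊆ B) :
    A = ∅ ∨ ∃ τ, A = {τ} :=
  (hB.anti hA).eq_empty_or_singleton

lemma envCount_cell {ω : Ω} {s t : ℝ≥0} (hst : s ≤ t)
    (h : (R.jumps ω ∩ Ioc s t).Subsingleton) :
    R.envCount t ω = R.envCount s ω + R.cellMoves s t ω := by
  rw [cellMoves, envCount_eq_cnt, envCount_eq_cnt]
  rcases eq_empty_or_singleton h (inter_subset_inter_left _ subset_union_right) with h1 | ⟨τ, h1⟩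
  · rw [if_pos (J_eq_of_empty hst h1).symm, cnt_eq_of_empty hst h1, add_zero]
  · rw [if_neg (values_of_single_jump (R.chain.rightCont ω) (R.chain.leftLimit ω) h1).2.2,
      cnt_eq_of_singleton (R.finite_jumpSet_J ω) h1]

/-- With at most one event time, the endpoints reveal the claims: no transition follows an arrival
within the cell, so it is charged in state `J t`, and a transition leads from `J s` to `J t`. An
arrival and a transition at the same instant are allowed. -/
lemma claimSum_cell {ω : Ω} {s t : ℝ≥0} (hst : s ≤ t)
    (h : (R.jumps ω ∩ Ioc s t).Subsingleton) :
    R.claimSum t ω = R.claimSum s ω + R.cellClaims (R.envCount t ω) s t ω := by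
  have hN : ∑ k ∈ Finset.Icc 1 (R.N t ω), R.C k (R.J (R.arrivalEpoch k ω).toNNReal ω) ω =
      ∑ k ∈ Finset.Icc 1 (R.N s ω), R.C k (R.J (R.arrivalEpoch k ω).toNNReal ω) ω +
      ∑ q ∈ Finset.Ioc (R.N s ω) (R.N t ω), R.C q (R.J t ω) ω := by
    rcases eq_empty_or_singleton h (inter_subset_inter_left _ subset_union_left) with h1 | ⟨τ, h1⟩
    · rw [R.N_eq_cnt t, cnt_eq_of_empty hst h1, ← R.N_eq_cnt]
      simp
    · have hc := cnt_eq_of_singleton (R.finite_jumpSet_N ω) h1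
      have he : R.arrivalEpoch (R.N t ω) ω = τ := by
        rw [R.N_eq_cnt t]
        exact epoch_cnt_of_singleton (zero_notMem_jumpSet _) (R.finite_jumpSet_N ω) h1
      have hτ : τ ∈ (jumpSet fun t => R.N t ω) ∩ Ioc s t := h1 ▸ mem_singleton τ
      have hJ : R.J t ω = R.J τ ω := by
        refine J_eq_of_empty hτ.2.2 ?_
        ext u
        simp only [mem_inter_iff, mem_Ioc, mem_empty_iff_false, iff_false]
        rintro ⟨hu, h2, h3⟩
        exact h2.ne' (h ⟨Or.inr hu, hτ.2.1.trans h2, h3⟩ ⟨Or.inl hτ.1, hτ.2⟩)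
      rw [← R.N_eq_cnt, ← R.N_eq_cnt] at hc
      rw [hc] at he ⊢
      rw [Finset.sum_Icc_succ_top (by omega), Nat.Ioc_succ_singleton, Finset.sum_singleton, he,
        ENNReal.toNNReal_coe, hJ]
  have hJ : ∑ k ∈ Finset.Icc 1 (R.envCount t ω),
        R.D k (Function.leftLim (fun s => R.J s ω) (R.envEpoch k ω).toNNReal)
          (R.J (R.envEpoch k ω).toNNReal ω) ω =
      ∑ k ∈ Finset.Icc 1 (R.envCount s ω),
        R.D k (Function.leftLim (fun s => R.J s ω) (R.envEpoch k ω).toNNReal)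
          (R.J (R.envEpoch k ω).toNNReal ω) ω +
      if R.J s ω = R.J t ω then 0 else R.D (R.envCount t ω) (R.J s ω) (R.J t ω) ω := by
    rcases eq_empty_or_singleton h (inter_subset_inter_left _ subset_union_right) with h1 | ⟨τ, h1⟩
    · rw [if_pos (J_eq_of_empty hst h1).symm, R.envCount_eq_cnt t, cnt_eq_of_empty hst h1, add_zero,
        R.envCount_eq_cnt s]
    · have hc : R.envCount t ω = R.envCount s ω + 1 :=
        cnt_eq_of_singleton (R.finite_jumpSet_J ω) h1
      have he : R.envEpoch (R.envCount t ω) ω = τ :=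
        epoch_cnt_of_singleton (zero_notMem_jumpSet _) (R.finite_jumpSet_J ω) h1
      obtain ⟨v1, v2, v3⟩ :=
        values_of_single_jump (R.chain.rightCont ω) (R.chain.leftLimit ω) h1
      rw [hc] at he ⊢
      rw [if_neg v3, Finset.sum_Icc_succ_top (by omega), he, ENNReal.toNNReal_coe, v1, v2]
  rw [claimSum, claimSum, cellClaims, hN, hJ]
  ring

variable (R)

/-! ### Discretisation -/

/-- The number of transitions seen on the grid of mesh `h` before the grid point `a h`. -/
def gridMoves (h : ℝ≥0) (a : ℕ) (ω : Ω) : ℕ :=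
  ∑ b ∈ Finset.range a, R.cellMoves ((b : ℕ) * h) ((b + 1 : ℕ) * h) ω

/-- The cells of the risk process as seen on the grid of mesh `h`. -/
def gridCell (h : ℝ≥0) (ω : Ω) (a : ℕ) : Site n :=
  ((R.J ((a + 1 : ℕ) * h) ω,
    R.N ((a + 1 : ℕ) * h) ω - R.N ((a : ℕ) * h) ω + R.cellMoves ((a : ℕ) * h) ((a + 1 : ℕ) * h) ω),
    h * θ.p (R.J ((a + 1 : ℕ) * h) ω) -
      R.cellClaims (R.gridMoves h (a + 1) ω) ((a : ℕ) * h) ((a + 1 : ℕ) * h) ω)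

/-- The cells of the risk process over unit intervals. -/
def unitCell (ω : Ω) (k : ℕ) : Site n :=
  ((R.J (k + 1 : ℕ) ω,
    (R.N (k + 1 : ℕ) ω - R.N (k : ℕ) ω) + (R.envCount (k + 1 : ℕ) ω - R.envCount (k : ℕ) ω)),
    R.X 0 (k + 1 : ℕ) ω - R.X 0 (k : ℕ) ω)

variable {R}

lemma grid_mono (h : ℝ≥0) (a : ℕ) : ((a : ℕ) : ℝ≥0) * h ≤ ((a + 1 : ℕ) : ℝ≥0) * h := by
  gcongr; omega

lemma gridMoves_eq {h : ℝ≥0} {m : ℕ} {ω : Ω}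
    (hs : ∀ a < m, (R.jumps ω ∩ Ioc ((a : ℕ) * h) ((a + 1 : ℕ) * h)).Subsingleton) :
    R.gridMoves h m ω = R.envCount (m * h) ω := by
  induction m with
  | zero =>
    simp only [gridMoves, Finset.range_zero, Finset.sum_empty, Nat.cast_zero, zero_mul]
    exact (cnt_zero (zero_notMem_jumpSet _)).symm
  | succ m ih =>
    rw [envCount_cell (grid_mono h m) (hs m (by omega)), ← ih fun a ha => hs a (by omega),
      gridMoves, gridMoves, Finset.sum_range_succ]

lemma sum_gridCell_count {h : ℝ≥0} {ω : Ω} (b m : ℕ)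
    (hs : ∀ a < b + m, (R.jumps ω ∩ Ioc ((a : ℕ) * h) ((a + 1 : ℕ) * h)).Subsingleton) :
    ∑ a ∈ Finset.range m, (R.gridCell h ω (b + a)).1.2 =
      (R.N ((b + m : ℕ) * h) ω - R.N ((b : ℕ) * h) ω) +
        (R.envCount ((b + m : ℕ) * h) ω - R.envCount ((b : ℕ) * h) ω) := by
  induction m with
  | zero => simp
  | succ m ih =>
    rw [Finset.sum_range_succ, ih fun a ha => hs a (by omega)]
    have h1 := envCount_cell (grid_mono h (b + m)) (hs (b + m) (by omega))
    have h2 : R.N (((b + m : ℕ) : ℝ≥0) * h) ω ≤ R.N (((b + m + 1 : ℕ) : ℝ≥0) * h) ω :=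
      R.arrivals.mono ω (grid_mono h (b + m))
    have h0 : ((b : ℕ) : ℝ≥0) * h ≤ ((b + m : ℕ) : ℝ≥0) * h := by gcongr; omega
    have h3 : R.N (((b : ℕ) : ℝ≥0) * h) ω ≤ R.N (((b + m : ℕ) : ℝ≥0) * h) ω :=
      R.arrivals.mono ω h0
    have h4 : R.envCount (((b : ℕ) : ℝ≥0) * h) ω ≤ R.envCount (((b + m : ℕ) : ℝ≥0) * h) ω :=
      R.envCount_mono ω h0
    simp only [gridCell, ← add_assoc]
    omega

lemma sum_gridCell_increment {h : ℝ≥0} {ω : Ω} (b m : ℕ)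
    (hs : ∀ a < b + m, (R.jumps ω ∩ Ioc ((a : ℕ) * h) ((a + 1 : ℕ) * h)).Subsingleton) :
    ∑ a ∈ Finset.range m, (R.gridCell h ω (b + a)).2 =
      ∑ a ∈ Finset.range m, h * θ.p (R.J ((b + a + 1 : ℕ) * h) ω) -
        (R.claimSum ((b + m : ℕ) * h) ω - R.claimSum ((b : ℕ) * h) ω) := by
  induction m with
  | zero => simp
  | succ m ih =>
    rw [Finset.sum_range_succ, ih fun a ha => hs a (by omega), Finset.sum_range_succ]
    have h1 := claimSum_cell (grid_mono h (b + m)) (hs (b + m) (by omega))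
    rw [← gridMoves_eq (m := b + m + 1) fun a ha => hs a (by omega)] at h1
    simp only [gridCell, ← add_assoc]
    rw [h1]
    ring

/-- Measurability in time comes from right-continuity, through pointwise convergence of grid
samples. The truncation `max u 0` supplies the nonnegative argument that `tendsto_grid_ceil`
requires. -/
lemma intervalIntegrable_comp_rightCont {S : Type*} [Finite S] [TopologicalSpace S] [DiscreteTopology S]
    {f : ℝ≥0 → S} (hr : ∀ t, ContinuousWithinAt f (Ici t) t) (g : S → ℝ) (a b : ℝ) :
    IntervalIntegrable (fun u => g (f u.toNNReal)) volume a b := by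
  obtain ⟨C, hC⟩ : ∃ C, ∀ s, ‖g s‖ ≤ C := by
    obtain ⟨C, hC⟩ := (Set.finite_range fun s => ‖g s‖).bddAbove
    exact ⟨C, fun s => hC ⟨s, rfl⟩⟩
  let F : ℕ → ℝ → ℝ := fun l u =>
    g (f ((⌈max u 0 / (1 / (l + 1) : ℝ≥0)⌉₊ : ℝ≥0) * (1 / (l + 1))))
  have hmeas : ∀ l, Measurable (F l) := by
    intro l
    have h1 : Measurable fun q : ℕ => g (f ((q : ℝ≥0) * (1 / (l + 1)))) := measurable_of_countable _
    exact h1.comp (Nat.measurable_ceil.comp ((measurable_id.max measurable_const).div_const _))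
  have hm : Measurable fun u : ℝ => g (f u.toNNReal) := by
    refine measurable_of_tendsto_metrizable hmeas (tendsto_pi_nhds.2 fun u => ?_)
    have h1 := (hr (max u 0).toNNReal).tendsto.comp
      (tendsto_grid_ceil one_pos (max u 0) (le_max_right _ _))
    have h2 : (max u 0).toNNReal = u.toNNReal := by simp [Real.toNNReal]
    rw [h2] at h1
    exact (continuous_of_discreteTopology (f := g)).continuousAt.tendsto.comp h1
  exact intervalIntegrable_const (c := C) |>.mono_fun hm.aestronglyMeasurable
      (Eventually.of_forall fun u => (hC _).trans (le_abs_self C))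

lemma X_sub_X (x : ℝ) (s t : ℝ≥0) (ω : Ω) : R.X x t ω - R.X x s ω =
    (∫ u in (s : ℝ)..(t : ℝ), θ.p (R.J u.toNNReal ω)) - (R.claimSum t ω - R.claimSum s ω) := by
  have hi := fun a b => intervalIntegrable_comp_rightCont (R.chain.rightCont ω) θ.p a b
  rw [X_eq, X_eq, ← intervalIntegral.integral_interval_sub_left (hi 0 t) (hi 0 s)]
  ring

/-- The aggregated grid cells converge to the unit cells. -/
lemma tendsto_block_gridCell (ω : Ω) (k : ℕ) :
    Tendsto (fun l : ℕ => block l (R.gridCell (1 / (l + 1)) ω) k) atTop (𝓝 (R.unitCell ω k)) := by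
  have hh := tendsto_mesh 1
  have hcast : ∀ l q : ℕ, ((q * (l + 1) : ℕ) : ℝ≥0) * (1 / ((l : ℝ≥0) + 1)) = (q : ℕ) := by
    intro l q; push_cast; field_simp
  have hev : ∀ᶠ l : ℕ in atTop, ∀ a < k * (l + 1) + (l + 1), (R.jumps ω ∩
      Ioc ((a : ℕ) * (1 / ((l : ℝ≥0) + 1))) ((a + 1 : ℕ) * (1 / ((l : ℝ≥0) + 1)))).Subsingleton := by
    filter_upwards [eventually_subsingleton_cells (R.finite_jumps ω) hh (k + 1 : ℕ)] with l hl a ha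
    refine hl _ _ ?_ ?_
    · rw [← hcast l (k + 1)]
      gcongr
      nlinarith
    · push_cast; rw [add_mul, one_mul]
  have hk : ∀ l : ℕ, k * (l + 1) + (l + 1) = (k + 1) * (l + 1) := fun l => by ring
  -- Once each grid cell has at most one event time, the marks agree exactly and the claims cancel
  -- exactly; only the premium term is a genuine limit.
  have hmark : ∀ᶠ l : ℕ in atTop,
      (block l (R.gridCell (1 / (l + 1)) ω) k).1 = (R.unitCell ω k).1 := by
    filter_upwards [hev] with l hl
    have h1 := sum_gridCell_count (k * (l + 1)) (l + 1) hl
    rw [hk, hcast, hcast] at h1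
    simp only [block, agg, iterate_shift, unitCell]
    refine Prod.ext ?_ ?_
    · simp only [gridCell]
      have : l + k * (l + 1) + 1 = (k + 1) * (l + 1) := by ring
      rw [this, hcast]
    · simp only [add_comm _ (k * (l + 1))]
      exact h1
  have hinc : ∀ᶠ l : ℕ in atTop, (∑ a ∈ Finset.range (l + 1),
        ((1 / (l + 1) : ℝ≥0) : ℝ) *
          θ.p (R.J (((k * (l + 1) + a + 1 : ℕ) : ℝ≥0) * (1 / (l + 1))) ω)) -
        (R.claimSum (k + 1 : ℕ) ω - R.claimSum (k : ℕ) ω) =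
      (block l (R.gridCell (1 / (l + 1)) ω) k).2 := by
    filter_upwards [hev] with l hl
    have h1 := sum_gridCell_increment (k * (l + 1)) (l + 1) hl
    rw [hk, hcast, hcast] at h1
    simp only [block, agg, iterate_shift, add_comm _ (k * (l + 1))]
    exact h1.symm
  have hlim := (tendsto_riemann_sum (R.chain.rightCont ω) θ.p one_pos k).sub_const
    (R.claimSum (k + 1 : ℕ) ω - R.claimSum (k : ℕ) ω)
  rw [nhds_prod_eq]
  refine Tendsto.prodMk (tendsto_const_nhds.congr' (hmark.mono fun l hl => hl.symm)) ?_
  have : (R.unitCell ω k).2 = _ := X_sub_X 0 (k : ℕ) (k + 1 : ℕ) ω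
  rw [this]
  refine Tendsto.congr' hinc ?_
  simpa using hlim

end Model

end MMRisk

end

/-! ### Markov additivity of the environment and the arrivals. -/

noncomputable section

namespace MMRisk

variable {n : ℕ}

/-- `ProductLaw` for functions in place of sets. -/
lemma Renewal.lintegral_prod {L : Fin n → Measure (ℕ → Site n)} [∀ i, IsProbabilityMeasure (L i)]
    (h : Renewal L) (i : Fin n) (m : ℕ) (f : ℕ → Site n → ℝ≥0∞) (d : ℕ → Fin n × ℕ)
    (hf : ∀ k, Measurable (f k)) (hd : ∀ k s, s.1 ≠ d k → f k s = 0) :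
    ∫⁻ x, ∏ k ∈ Finset.range m, f k (x k) ∂L i =
      ∏ k ∈ Finset.range m, ∫⁻ x, f k (x 0) ∂L (startState i d k) := by
  induction m generalizing i f d with
  | zero => simp
  | succ m ih =>
    rw [Finset.prod_range_succ']
    simp only [Finset.prod_range_succ' _ m]
    let F : Site n × (ℕ → Site n) → ℝ≥0∞ := fun p =>
      (∏ k ∈ Finset.range m, f (k + 1) (p.2 k)) * f 0 p.1
    have hprod : Measurable fun y : ℕ → Site n => ∏ k ∈ Finset.range m, f (k + 1) (y k) :=
      Finset.measurable_prod _ fun k _ => (hf (k + 1)).comp (measurable_pi_apply k)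
    have hF : Measurable F := (hprod.comp measurable_snd).mul ((hf 0).comp measurable_fst)
    have h1 := h.lintegral i hF
    refine Eq.trans h1 ?_
    -- The first factor vanishes off the mark `d 0`, so the remaining product is integrated under
    -- the fixed law `L (d 0).1`.
    have h2 : ∀ x : ℕ → Site n, ∫⁻ y, F (x 0, y) ∂L (x 0).1.1 =
        (∏ k ∈ Finset.range m, ∫⁻ y, f (k + 1) (y 0) ∂L (startState i d (k + 1))) * f 0 (x 0) := by
      intro x
      by_cases hx : (x 0).1 = d 0
      · have := ih (d 0).1 (fun k => f (k + 1)) (shift d) (fun k => hf (k + 1))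
          fun k s hs => hd (k + 1) s hs
        simp only [startState_shift i] at this
        simp only [F]
        rw [lintegral_mul_const _ hprod, hx, this]
      · have : f 0 (x 0) = 0 := hd 0 _ hx
        simp [F, this]
    simp only [h2]
    have h0 : Measurable fun x : ℕ → Site n => f 0 (x 0) := (hf 0).comp (measurable_pi_apply 0)
    rw [lintegral_const_mul _ h0]
    rfl

lemma measurable_sigma {ι Ω S : Type*} [MeasurableSpace S] (Z : ι → Ω → S) (a : ι) :
    Measurable[sigma Z] (Z a) :=
  (comap_measurable (Z a)).mono (le_iSup (fun a => MeasurableSpace.comap (Z a) inferInstance) a)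
    le_rfl

namespace Model

variable {θ : Params n} {Ω : Type*} [MeasurableSpace Ω] (R : Model θ Ω)

lemma isProbabilityMeasure_map {β : Type*} [MeasurableSpace β] {f : Ω → β} (hf : Measurable f)
    (i : Fin n) : IsProbabilityMeasure ((R.P i).map f) := by
  have := R.prob i
  exact Measure.isProbabilityMeasure_map hf.aemeasurable

lemma ae_J_zero (i : Fin n) : ∀ᵐ ω ∂(R.P i), R.J 0 ω = i := by
  have := R.prob i
  have h := R.chain.law i 0 (fun _ => 0) (fun _ => i) (fun _ _ _ => le_rfl) rfl
  have hm : MeasurableSet {ω | R.J 0 ω = i} := R.chain.measurable 0 (measurableSet_singleton i)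
  refine (prob_compl_eq_zero_iff hm).2 ?_
  simpa using h

/-! ### The environment and its additive functionals on a grid -/

lemma monotone_grid (h : ℝ≥0) : Monotone fun k : ℕ => (k : ℝ≥0) * h := fun _ _ hab => by
  dsimp only; gcongr

lemma prob_J_grid (h : ℝ≥0) (i : Fin n) (m : ℕ) (d : ℕ → Fin n × ℕ) :
    R.P i {ω | ∀ k < m, R.J ((k + 1 : ℕ) * h) ω = (d k).1} =
      ∏ k ∈ Finset.range m, ENNReal.ofReal
        (NormedSpace.exp ((h : ℝ) • θ.Q) (startState i d k) (startState i d (k + 1))) := by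
  have hlaw := R.chain.law i m (fun k => (k : ℝ≥0) * h) (startState i d) (monotone_grid h) (by simp)
  have h1 : ∀ k : ℕ, ((((k + 1 : ℕ) : ℝ≥0) * h : ℝ≥0) : ℝ) - (((k : ℝ≥0) * h : ℝ≥0) : ℝ) = h := by
    intro k; push_cast; ring
  simp only [h1] at hlaw
  rw [startState, if_pos rfl, one_mul] at hlaw
  rw [← hlaw]
  refine measure_congr ?_
  filter_upwards [R.ae_J_zero i] with ω hω
  refine propext ⟨fun H k hk => ?_, fun H k hk => H (k + 1) hk⟩
  rcases k with _ | k
  · simpa using! hω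
  · exact H k hk

/-- The cells of the additive functional `∫ g (J u) du`, approximated on a grid. -/
def gridFunctional (g : Fin n → ℝ) (h : ℝ≥0) (ω : Ω) (a : ℕ) : Site n :=
  ((R.J ((a + 1 : ℕ) * h) ω, 0), h * g (R.J ((a + 1 : ℕ) * h) ω))

/-- The cells of length `H` of the additive functional `∫ g (J u) du`. -/
def functionalCell (g : Fin n → ℝ) (H : ℝ≥0) (ω : Ω) (k : ℕ) : Site n :=
  ((R.J ((k + 1 : ℕ) * H) ω, 0),
    ∫ u in ((k * H : ℝ≥0) : ℝ)..(((k + 1 : ℕ) * H : ℝ≥0) : ℝ), g (R.J u.toNNReal ω))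

lemma measurable_gridFunctional (g : Fin n → ℝ) (h : ℝ≥0) : Measurable (R.gridFunctional g h) := by
  refine measurable_pi_lambda _ fun a => ?_
  have hJ := R.chain.measurable ((a + 1 : ℕ) * h)
  exact (hJ.prodMk measurable_const).prodMk
    (measurable_const.mul ((measurable_of_countable g).comp hJ))

/-- The grid increment is a function of the state at the end of the cell, so a cylinder is either
empty or a cylinder event of the chain at grid times, whose probability is a product of transition
probabilities. -/
lemma renewal_gridFunctional (g : Fin n → ℝ) (h : ℝ≥0) :
    Renewal fun i => (R.P i).map (R.gridFunctional g h) := by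
  have hm := R.measurable_gridFunctional g h
  have := R.isProbabilityMeasure_map hm
  refine ProductLaw.renewal ?_
  classical
  have key : ∀ i m d B, (∀ k, MeasurableSet (B k)) →
      (R.P i).map (R.gridFunctional g h) (cyl m d B) = ∏ k ∈ Finset.range m,
        if (d k).2 = 0 ∧ h * g (d k).1 ∈ B k then ENNReal.ofReal
        (NormedSpace.exp ((h : ℝ) • θ.Q) (startState i d k) (d k).1) else 0 := by
    intro i m d B hB
    rw [Measure.map_apply hm (measurableSet_cyl hB)]
    by_cases hc : ∀ k < m, (d k).2 = 0 ∧ h * g (d k).1 ∈ B k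
    · rw [Finset.prod_congr rfl fun k hk => if_pos (hc k (Finset.mem_range.1 hk))]
      refine Eq.trans ?_ (R.prob_J_grid h i m d)
      congr 1
      ext ω
      simp only [mem_preimage, cyl, gridFunctional, mem_ofPred_eq]
      refine forall₂_congr fun k hk => ⟨fun H => congrArg Prod.fst H.1, fun H => ⟨?_, ?_⟩⟩
      · exact Prod.ext H (hc k hk).1.symm
      · rw [H]; exact (hc k hk).2
    · push Not at hc
      obtain ⟨k, hk, hck⟩ := hc
      rw [Finset.prod_eq_zero (Finset.mem_range.2 hk) (if_neg (by tauto))]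
      convert! measure_empty (μ := R.P i)
      ext ω
      simp only [mem_preimage, cyl, gridFunctional, mem_ofPred_eq, mem_empty_iff_false, iff_false]
      intro H
      have h1 := H k hk
      have h2 : R.J ((k + 1 : ℕ) * h) ω = (d k).1 := congrArg Prod.fst h1.1
      have h3 : 0 = (d k).2 := congrArg Prod.snd h1.1
      refine hck h3.symm ?_
      rw [← h2]
      exact h1.2
  intro i m d B hB
  rw [key i m d B hB]
  refine Finset.prod_congr rfl fun k _ => ?_
  have := key (startState i d k) 1 (fun _ => d k) (fun _ => B k) fun _ => hB k
  rw [Finset.prod_range_one] at this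
  refine this.symm.trans ?_
  congr 1
  ext x
  simp [cyl, firstSet]

lemma tendsto_block_gridFunctional (g : Fin n → ℝ) {H : ℝ≥0} (hH : 0 < H) (ω : Ω) (k : ℕ) :
    Tendsto (fun l : ℕ => block l (R.gridFunctional g (H / (l + 1)) ω) k) atTop
      (𝓝 (R.functionalCell g H ω k)) := by
  have e : ∀ l : ℕ, block l (R.gridFunctional g (H / (l + 1)) ω) k =
      ((R.J ((k + 1 : ℕ) * H) ω, 0), ∑ a ∈ Finset.range (l + 1), ((H / (l + 1) : ℝ≥0) : ℝ) *
        g (R.J (((k * (l + 1) + a + 1 : ℕ) : ℝ≥0) * (H / (l + 1))) ω)) := by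
    intro l
    simp only [block, agg, iterate_shift, gridFunctional]
    have h1 : ((l + k * (l + 1) + 1 : ℕ) : ℝ≥0) * (H / (l + 1)) = (k + 1 : ℕ) * H := by
      push_cast; field_simp; ring
    rw [h1]
    simp [add_comm]
  simp only [e]
  rw [functionalCell, nhds_prod_eq]
  exact tendsto_const_nhds.prodMk (tendsto_riemann_sum (R.chain.rightCont ω) g hH k)

lemma measurable_functionalCell (g : Fin n → ℝ) {H : ℝ≥0} (hH : 0 < H) :
    Measurable (R.functionalCell g H) := by
  refine measurable_pi_lambda _ fun k => ?_
  refine measurable_of_tendsto_metrizable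
    (f := fun (l : ℕ) ω => block l (R.gridFunctional g (H / (l + 1)) ω) k)
    (fun l => ?_) (tendsto_pi_nhds.2 fun ω => R.tendsto_block_gridFunctional g hH ω k)
  exact (measurable_pi_apply k).comp
    ((measurable_block l).comp (R.measurable_gridFunctional g _))

lemma renewal_functionalCell (g : Fin n → ℝ) {H : ℝ≥0} (hH : 0 < H) :
    Renewal fun i => (R.P i).map (R.functionalCell g H) := by
  have := R.prob
  refine Renewal.of_tendsto (ξ := fun l ω => block l (R.gridFunctional g (H / (l + 1)) ω))
    (fun l => (measurable_block l).comp (R.measurable_gridFunctional g _))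
    (R.measurable_functionalCell g hH) (fun l => ?_) (R.tendsto_block_gridFunctional g hH)
  have hm := R.measurable_gridFunctional g (H / (l + 1))
  have := R.isProbabilityMeasure_map hm
  have h := (R.renewal_gridFunctional g (H / (l + 1))).block l
  simp only [Measure.map_map (measurable_block l) hm] at h
  exact h

/-! ### The environment and the arrivals on a grid -/

lemma measurableSet_J_grid (h : ℝ≥0) (m : ℕ) (d : ℕ → Fin n) :
    MeasurableSet[sigma R.J] {ω | ∀ k < m, R.J ((k + 1 : ℕ) * h) ω = d k} := by
  have : {ω | ∀ k < m, R.J ((k + 1 : ℕ) * h) ω = d k} =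
      ⋂ k ∈ Finset.range m, R.J ((k + 1 : ℕ) * h) ⁻¹' {d k} := by
    ext ω; simp
  rw [this]
  exact Finset.measurableSet_biInter _ fun k _ =>
    measurable_sigma R.J _ (measurableSet_singleton _)

/-- Given the environment, the counts are independent Poisson with means the cells of the integrated
intensity. The probability is therefore the integral of a product over a Markov additive sequence,
which factors; the same formula with one cell identifies each factor. -/
lemma prob_JN_grid {h : ℝ≥0} (hh : 0 < h) (i : Fin n) (m : ℕ) (d : ℕ → Fin n × ℕ) (c : ℕ → ℕ) :
    R.P i {ω | ∀ k < m, R.J ((k + 1 : ℕ) * h) ω = (d k).1 ∧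
        R.N ((k + 1 : ℕ) * h) ω = R.N ((k : ℕ) * h) ω + c k} =
      ∏ k ∈ Finset.range m,
        R.P (startState i d k) {ω | R.J h ω = (d k).1 ∧ R.N h ω = c k} := by
  let φ : ℕ → ℝ → ℝ≥0∞ := fun q z =>
    ENNReal.ofReal (Real.exp (-z) * z ^ q / (Nat.factorial q : ℝ))
  have hφ : ∀ q, Measurable (φ q) := fun q => by fun_prop
  let f : ℕ → Site n → ℝ≥0∞ := fun k s => if s.1 = ((d k).1, 0) then φ (c k) s.2 else 0
  have hf : ∀ k, Measurable (f k) := fun k =>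
    Measurable.ite (measurable_fst (measurableSet_singleton _)) ((hφ _).comp measurable_snd)
      measurable_const
  have hm := R.measurable_functionalCell θ.lam hh
  have := R.isProbabilityMeasure_map hm
  have key : ∀ i m (d : ℕ → Fin n × ℕ) (c : ℕ → ℕ),
      R.P i {ω | ∀ k < m, R.J ((k + 1 : ℕ) * h) ω = (d k).1 ∧
        R.N ((k + 1 : ℕ) * h) ω = R.N ((k : ℕ) * h) ω + c k} =
      ∫⁻ x, ∏ k ∈ Finset.range m, (if (x k).1 = ((d k).1, 0) then φ (c k) (x k).2 else 0)
        ∂(R.P i).map (R.functionalCell θ.lam h) := by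
    intro i m d c
    have hA := R.measurableSet_J_grid h m fun k => (d k).1
    have hA' : MeasurableSet {ω | ∀ k < m, R.J ((k + 1 : ℕ) * h) ω = (d k).1} :=
      (iSup_le fun t => (R.chain.measurable t).comap_le : sigma R.J ≤ _) _ hA
    have hlaw := R.arrivals.law i m (fun k => (k : ℝ≥0) * h) c _ (monotone_grid h) hA
    have hF : Measurable fun x : ℕ → Site n => ∏ k ∈ Finset.range m,
        (if (x k).1 = ((d k).1, 0) then φ (c k) (x k).2 else 0) := by
      refine Finset.measurable_prod _ fun k _ => Measurable.ite
        (measurableSet_eq_fun (by fun_prop) measurable_const) ?_ measurable_const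
      exact (hφ _).comp (measurable_snd.comp (measurable_pi_apply k))
    rw [lintegral_map hF hm]
    rw [← lintegral_indicator hA'] at hlaw
    have e : {ω | ∀ k < m, R.J ((k + 1 : ℕ) * h) ω = (d k).1 ∧
        R.N ((k + 1 : ℕ) * h) ω = R.N ((k : ℕ) * h) ω + c k} =
        {ω | ∀ k < m, R.J ((k + 1 : ℕ) * h) ω = (d k).1} ∩
        {ω | ∀ k < m, R.N ((k + 1 : ℕ) * h) ω = R.N ((k : ℕ) * h) ω + c k} := by
      ext ω
      simp only [mem_ofPred_eq, mem_inter_iff]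
      exact ⟨fun H => ⟨fun k hk => (H k hk).1, fun k hk => (H k hk).2⟩,
        fun H k hk => ⟨H.1 k hk, H.2 k hk⟩⟩
    rw [e]
    refine hlaw.trans (lintegral_congr fun ω => ?_)
    by_cases hω : ∀ k < m, R.J ((k + 1 : ℕ) * h) ω = (d k).1
    · rw [indicator_of_mem (by exact hω)]
      refine Finset.prod_congr rfl fun k hk => ?_
      rw [if_pos]
      · rfl
      · simp only [functionalCell]
        rw [hω k (Finset.mem_range.1 hk)]
    · rw [indicator_of_notMem (by exact hω)]
      push Not at hω
      obtain ⟨k, hk, hne⟩ := hω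
      rw [Finset.prod_eq_zero (Finset.mem_range.2 hk)]
      rw [if_neg]
      exact fun H => hne (congrArg Prod.fst H)
  have hst : ∀ k, startState i d k = startState i (fun k => ((d k).1, 0)) k := by
    rintro (_ | k) <;> rfl
  rw [key, (R.renewal_functionalCell θ.lam hh).lintegral_prod i m f (fun k => ((d k).1, 0)) hf
    fun k s hs => if_neg hs]
  refine Finset.prod_congr rfl fun k _ => ?_
  have := key (startState i d k) 1 (fun _ => d k) fun _ => c k
  simp only [Finset.prod_range_one, Nat.lt_one_iff, forall_eq] at this
  rw [← hst]
  refine this.symm.trans ?_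
  congr 1
  ext ω
  simp [R.arrivals.zero]

end Model

end MMRisk

end

/-! ### The claims and Markov additivity of the risk process. -/

noncomputable section

namespace MMRisk

/-! ### Sums over disjoint blocks of independent random variables -/

lemma prob_block_sums {Ω ι : Type*} [MeasurableSpace Ω] {μ : Measure Ω} {Z : ι → Ω → ℝ}
    (hZ : iIndepFun Z μ) (hm : ∀ t, Measurable (Z t)) (T : ℕ → Finset ι)
    (hT : ∀ k k', k < k' → Disjoint (T k) (T k')) (B : ℕ → Set ℝ) (hB : ∀ k, MeasurableSet (B k))
    (m : ℕ) : μ {ω | ∀ k < m, ∑ t ∈ T k, Z t ω ∈ B k} =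
      ∏ k ∈ Finset.range m, μ {ω | ∑ t ∈ T k, Z t ω ∈ B k} := by
  classical
  have := hZ.isProbabilityMeasure
  induction m with
  | zero => simp
  | succ m ih =>
    let S := (Finset.range m).biUnion T
    have hdisj : Disjoint S (T m) := (Finset.disjoint_biUnion_left _ _ _).2 fun k hk =>
      hT k m (Finset.mem_range.1 hk)
    have hind := hZ.indepFun_finset S (T m) hdisj hm
    let f : ℕ → (S → ℝ) → ℝ := fun k y => ∑ t ∈ T k, if ht : t ∈ S then y ⟨t, ht⟩ else 0
    have hf : ∀ k, Measurable (f k) := fun k => Finset.measurable_sum _ fun t _ => by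
      by_cases ht : t ∈ S <;> simp only [ht, dite_true, dite_false] <;> fun_prop
    let g : (T m → ℝ) → ℝ := fun y => ∑ t, y t
    have hg : Measurable g := by fun_prop
    have hE : MeasurableSet {y : S → ℝ | ∀ k < m, f k y ∈ B k} := by
      have : {y : S → ℝ | ∀ k < m, f k y ∈ B k} = ⋂ k ∈ Finset.range m, f k ⁻¹' B k := by
        ext y; simp
      rw [this]
      exact Finset.measurableSet_biInter _ fun k _ => hf k (hB k)
    have hfS : ∀ k < m, ∀ ω, f k (fun t => Z t ω) = ∑ t ∈ T k, Z t ω := fun k hk ω =>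
      Finset.sum_congr rfl fun t ht =>
        dif_pos (Finset.mem_biUnion.2 ⟨k, Finset.mem_range.2 hk, ht⟩)
    have hgT : ∀ ω, g (fun t => Z t ω) = ∑ t ∈ T m, Z t ω := fun ω =>
      Finset.sum_coe_sort (T m) fun t => Z t ω
    have key := hind.measure_inter_preimage_eq_mul _ _ hE (hg (hB m))
    have e1 : (fun a (i : S) => Z i a) ⁻¹' {y : S → ℝ | ∀ k < m, f k y ∈ B k} =
        {ω | ∀ k < m, ∑ t ∈ T k, Z t ω ∈ B k} := by
      ext ω
      refine forall₂_congr fun k hk => ?_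
      rw [hfS k hk ω]
    have e2 : (fun a (i : T m) => Z i a) ⁻¹' (g ⁻¹' B m) = {ω | ∑ t ∈ T m, Z t ω ∈ B m} := by
      ext ω
      simp only [mem_preimage, hgT, mem_ofPred_eq]
    rw [e1, e2, ih] at key
    rw [Finset.prod_range_succ, ← key]
    congr 1
    ext ω
    simp only [mem_ofPred_eq, mem_inter_iff, Nat.lt_succ_iff_lt_or_eq]
    exact ⟨fun H => ⟨fun k hk => H k (Or.inl hk), H m (Or.inr rfl)⟩,
      fun H k hk => hk.elim (H.1 k) fun h => h ▸ H.2⟩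

/-- An independent family has the product of its marginals as joint law, so equal marginals give
equal laws of all sums. -/
lemma prob_sum_congr {Ω ι : Type*} [MeasurableSpace Ω] {μ μ' : Measure Ω} {Z Z' : ι → Ω → ℝ}
    (hZ : iIndepFun Z μ) (hZ' : iIndepFun Z' μ') (hm : ∀ t, Measurable (Z t))
    (hm' : ∀ t, Measurable (Z' t)) (h : ∀ t, μ.map (Z t) = μ'.map (Z' t)) (T : Finset ι)
    {B : Set ℝ} (hB : MeasurableSet B) :
    μ {ω | ∑ t ∈ T, Z t ω ∈ B} = μ' {ω | ∑ t ∈ T, Z' t ω ∈ B} := by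
  have := hZ.isProbabilityMeasure
  have := hZ'.isProbabilityMeasure
  have key : μ.map (fun ω t => Z t ω) = μ'.map (fun ω t => Z' t ω) := by
    rw [hZ.map_fun_eq_infinitePi_map hm, hZ'.map_fun_eq_infinitePi_map hm']
    simp only [h]
  have hs : MeasurableSet {y : ι → ℝ | ∑ t ∈ T, y t ∈ B} := by
    have : Measurable fun y : ι → ℝ => ∑ t ∈ T, y t := by fun_prop
    exact this hB
  have := congrArg (fun ν => ν {y : ι → ℝ | ∑ t ∈ T, y t ∈ B}) key
  simp only [Measure.map_apply (measurable_pi_lambda _ hm) hs,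
    Measure.map_apply (measurable_pi_lambda _ hm') hs] at this
  exact this

variable {n : ℕ}

/-- The indices of the arriving claims with numbers in `(q₀, q₁]`, if they arrive in state `l`, and
of the `r`-th transition claim, if there is a transition from `j` to `l ≠ j`. -/
def claimBlock (q₀ q₁ r : ℕ) (j l : Fin n) : Finset ((ℕ × Fin n) ⊕ (ℕ × Fin n × Fin n)) :=
  (Finset.Ioc q₀ q₁ ×ˢ {l}).disjSum (if j = l then ∅ else {(r, j, l)})

lemma sum_claimBlock (q₀ q₁ r : ℕ) (j l : Fin n)
    (Z : (ℕ × Fin n) ⊕ (ℕ × Fin n × Fin n) → ℝ) : ∑ t ∈ claimBlock q₀ q₁ r j l, Z t =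
      ∑ q ∈ Finset.Ioc q₀ q₁, Z (Sum.inl (q, l)) + if j = l then 0 else Z (Sum.inr (r, j, l)) := by
  rw [claimBlock, Finset.sum_disjSum, Finset.sum_product]
  simp only [Finset.sum_singleton]
  split_ifs <;> simp

/-- A later cell without a transition contains no transition claim, so its number `r'` matters only
when `j' ≠ l'`. -/
lemma disjoint_claimBlock {q₀ q₁ q₂ q₃ r r' : ℕ} {j l j' l' : Fin n} (hq : q₁ ≤ q₂)
    (hr : j' ≠ l' → r < r') : Disjoint (claimBlock q₀ q₁ r j l) (claimBlock q₂ q₃ r' j' l') := by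
  rw [Finset.disjoint_left]
  rintro (⟨q, s⟩ | ⟨u, a, b⟩) h1 h2
  · simp only [claimBlock, Finset.inl_mem_disjSum, Finset.mem_product, Finset.mem_Ioc] at h1 h2
    omega
  · simp only [claimBlock, Finset.inr_mem_disjSum] at h1 h2
    split_ifs at h1 h2 with hj hj'
    all_goals simp_all

/-- Renumbering of the claims. -/
def relabel (q₀ r₀ : ℕ) (t : (ℕ × Fin n) ⊕ (ℕ × Fin n × Fin n)) :
    (ℕ × Fin n) ⊕ (ℕ × Fin n × Fin n) :=
  t.map (fun a => (a.1 + q₀, a.2)) fun b => (b.1 + r₀, b.2)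

lemma relabel_injective (q₀ r₀ : ℕ) : Function.Injective (relabel (n := n) q₀ r₀) := by
  refine Function.Injective.sumMap ?_ ?_
  · rintro ⟨a, b⟩ ⟨a', b'⟩ h
    simpa using h
  · rintro ⟨a, b⟩ ⟨a', b'⟩ h
    simpa using h

lemma sum_claimBlock_relabel (q₀ c r₀ r : ℕ) (j l : Fin n) (hr : j ≠ l → r = 1 + r₀)
    (Z : (ℕ × Fin n) ⊕ (ℕ × Fin n × Fin n) → ℝ) :
    ∑ t ∈ claimBlock q₀ (q₀ + c) r j l, Z t =
      ∑ t ∈ claimBlock 0 c 1 j l, Z (relabel q₀ r₀ t) := by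
  rw [sum_claimBlock, sum_claimBlock]
  congr 1
  · have : Finset.Ioc q₀ (q₀ + c) = (Finset.Ioc 0 c).map (addRightEmbedding q₀) := by
      rw [Finset.map_add_right_Ioc, zero_add, add_comm c]
    rw [this, Finset.sum_map]
    rfl
  · split_ifs with h
    · rfl
    · rw [hr h]; rfl

namespace Model

variable {θ : Params n} {Ω : Type*} [MeasurableSpace Ω] (R : Model θ Ω)

/-- The claims of the model as one family. -/
abbrev claims : (ℕ × Fin n) ⊕ (ℕ × Fin n × Fin n) → Ω → ℝ := allClaims R.C R.D

lemma measurable_claims (t : (ℕ × Fin n) ⊕ (ℕ × Fin n × Fin n)) : Measurable (R.claims t) := by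
  rcases t with ⟨k, j⟩ | ⟨k, j, l⟩
  · exact R.C_measurable k j
  · exact R.D_measurable k j l

lemma map_claims_relabel (i i' : Fin n) (q₀ r₀ : ℕ) (t : (ℕ × Fin n) ⊕ (ℕ × Fin n × Fin n)) :
    (R.P i).map (R.claims (relabel q₀ r₀ t)) = (R.P i').map (R.claims t) := by
  rcases t with ⟨k, j⟩ | ⟨k, j, l⟩
  · exact (R.C_law i _ j).trans (R.C_law i' k j).symm
  · exact (R.D_law i _ j l).trans (R.D_law i' k j l).symm

/-- Claim laws depend neither on the number of the claim nor on the initial state, so a block may be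
renumbered to start afresh. This lets the restarted process use claims numbered from 1. -/
lemma prob_claimBlock (i i' : Fin n) (q₀ c r : ℕ) (j l : Fin n) (hr : j ≠ l → 1 ≤ r)
    {B : Set ℝ} (hB : MeasurableSet B) :
    R.P i {ω | ∑ t ∈ claimBlock q₀ (q₀ + c) r j l, R.claims t ω ∈ B} =
      R.P i' {ω | ∑ t ∈ claimBlock 0 c 1 j l, R.claims t ω ∈ B} := by
  have e : ∀ ω, ∑ t ∈ claimBlock q₀ (q₀ + c) r j l, R.claims t ω =
      ∑ t ∈ claimBlock 0 c 1 j l, R.claims (relabel q₀ (r - 1) t) ω := fun ω =>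
    sum_claimBlock_relabel q₀ c (r - 1) r j l (fun h => by have := hr h; omega)
      fun t => R.claims t ω
  simp only [e]
  exact prob_sum_congr ((R.claims_iIndep i).precomp (relabel_injective q₀ (r - 1)))
    (R.claims_iIndep i') (fun t => R.measurable_claims _) R.measurable_claims
    (fun t => R.map_claims_relabel i i' q₀ (r - 1) t) _ hB

lemma cellClaims_eq (k : ℕ) (s t : ℝ≥0) (ω : Ω) : R.cellClaims k s t ω =
    ∑ e ∈ claimBlock (R.N s ω) (R.N t ω) k (R.J s ω) (R.J t ω), R.claims e ω := by
  rw [sum_claimBlock]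
  rfl

/-! ### Measurability -/

lemma measurable_diag {E β : Type*} [MeasurableSpace E] [Countable E] [MeasurableSingletonClass E]
    [MeasurableSpace β] {φ : E → Ω → β} {e : Ω → E} (hφ : ∀ a, Measurable (φ a))
    (he : Measurable e) : Measurable fun ω => φ (e ω) ω := by
  have : Measurable fun p : E × Ω => φ p.1 p.2 := measurable_from_prod_countable_right hφ
  exact this.comp (he.prodMk measurable_id)

lemma measurable_cellMoves (s t : ℝ≥0) : Measurable (R.cellMoves s t) :=
  Measurable.ite (measurableSet_eq_fun (R.chain.measurable s) (R.chain.measurable t))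
    measurable_const measurable_const

lemma measurable_gridMoves (h : ℝ≥0) (a : ℕ) : Measurable (R.gridMoves h a) :=
  Finset.measurable_sum _ fun _ _ => R.measurable_cellMoves _ _

lemma measurable_cellClaims {k : Ω → ℕ} (hk : Measurable k) (s t : ℝ≥0) :
    Measurable fun ω => R.cellClaims (k ω) s t ω := by
  have hφ : ∀ a : (ℕ × ℕ × ℕ) × Fin n × Fin n, Measurable fun ω =>
      ∑ e ∈ claimBlock a.1.1 a.1.2.1 a.1.2.2 a.2.1 a.2.2, R.claims e ω := fun a =>
    Finset.measurable_sum _ fun e _ => R.measurable_claims e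
  have he : Measurable fun ω => ((R.N s ω, R.N t ω, k ω), R.J s ω, R.J t ω) :=
    ((R.arrivals.measurable s).prodMk ((R.arrivals.measurable t).prodMk hk)).prodMk
      ((R.chain.measurable s).prodMk (R.chain.measurable t))
  have := measurable_diag hφ he
  simpa only [cellClaims_eq] using this

lemma measurable_gridCell (h : ℝ≥0) : Measurable (R.gridCell h) := by
  refine measurable_pi_lambda _ fun a => ?_
  have hJ := R.chain.measurable ((a + 1 : ℕ) * h)
  refine (hJ.prodMk (((R.arrivals.measurable _).sub (R.arrivals.measurable _)).add
    (R.measurable_cellMoves _ _))).prodMk ?_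
  exact (measurable_const.mul ((measurable_of_countable θ.p).comp hJ)).sub
    (R.measurable_cellClaims (R.measurable_gridMoves h _) _ _)

/-! ### The law of the grid cells -/

/-- The number of transitions in cell `k`, for given marks. -/
def moves (i : Fin n) (d : ℕ → Fin n × ℕ) (k : ℕ) : ℕ :=
  if startState i d k = startState i d (k + 1) then 0 else 1

/-- The number of arrivals before cell `k`, for given marks. -/
def arrivalsBefore (i : Fin n) (d : ℕ → Fin n × ℕ) (k : ℕ) : ℕ :=
  ∑ a ∈ Finset.range k, ((d a).2 - moves i d a)

/-- The number of transitions before cell `k`, for given marks. -/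
def movesBefore (i : Fin n) (d : ℕ → Fin n × ℕ) (k : ℕ) : ℕ := ∑ a ∈ Finset.range k, moves i d a

/-- The event that the environment and the arrivals have the given marks. -/
def pathEvent (h : ℝ≥0) (i : Fin n) (m : ℕ) (d : ℕ → Fin n × ℕ) : Set Ω :=
  {ω | ∀ k < m, R.J ((k + 1 : ℕ) * h) ω = (d k).1 ∧
    R.N ((k + 1 : ℕ) * h) ω + moves i d k = R.N ((k : ℕ) * h) ω + (d k).2}

/-- The claims in cell `k`, for given marks. -/
def pathBlock (i : Fin n) (d : ℕ → Fin n × ℕ) (k : ℕ) :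
    Finset ((ℕ × Fin n) ⊕ (ℕ × Fin n × Fin n)) :=
  claimBlock (arrivalsBefore i d k) (arrivalsBefore i d (k + 1)) (movesBefore i d (k + 1))
    (startState i d k) (startState i d (k + 1))

lemma prob_pathEvent {h : ℝ≥0} (hh : 0 < h) (i : Fin n) (m : ℕ) (d : ℕ → Fin n × ℕ) :
    R.P i (R.pathEvent h i m d) = ∏ k ∈ Finset.range m,
      R.P (startState i d k) {ω | R.J h ω = (d k).1 ∧ R.N h ω + moves i d k = (d k).2} := by
  -- The count in a mark includes the transition, so a mark with fewer events than transitions is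
  -- impossible and both sides vanish. Otherwise the truncated subtraction is exact.
  by_cases hg : ∀ k < m, moves i d k ≤ (d k).2
  · have := R.prob_JN_grid hh i m d fun k => (d k).2 - moves i d k
    convert! this using 1
    · congr 1
      ext ω
      refine forall₂_congr fun k hk => and_congr_right fun _ => ?_
      have := hg k hk
      omega
    · refine Finset.prod_congr rfl fun k hk => ?_
      congr 1
      ext ω
      refine and_congr_right fun _ => ?_
      have := hg k (Finset.mem_range.1 hk)
      omega
  · push Not at hg
    obtain ⟨k, hk, hlt⟩ := hg
    rw [Finset.prod_eq_zero (Finset.mem_range.2 hk)]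
    · convert! measure_empty (μ := R.P i)
      ext ω
      simp only [pathEvent, mem_ofPred_eq, mem_empty_iff_false, iff_false]
      intro H
      have h1 := (H k hk).2
      have h2 : R.N (((k : ℕ) : ℝ≥0) * h) ω ≤ R.N (((k + 1 : ℕ) : ℝ≥0) * h) ω :=
        R.arrivals.mono ω (grid_mono h k)
      omega
    · convert! measure_empty (μ := R.P (startState i d k))
      ext ω
      simp only [mem_ofPred_eq, mem_empty_iff_false, iff_false]
      omega

lemma measurableSet_pathEvent (h : ℝ≥0) (i : Fin n) (m : ℕ) (d : ℕ → Fin n × ℕ) :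
    MeasurableSet[sigma R.J ⊔ sigma R.N] (R.pathEvent h i m d) := by
  have hJ : ∀ t, Measurable[sigma R.J ⊔ sigma R.N] (R.J t) := fun t =>
    (measurable_sigma R.J t).mono le_sup_left le_rfl
  have hN : ∀ t, Measurable[sigma R.J ⊔ sigma R.N] (R.N t) := fun t =>
    (measurable_sigma R.N t).mono le_sup_right le_rfl
  have hNN : ∀ s t, Measurable[sigma R.J ⊔ sigma R.N] fun ω => (R.N s ω, R.N t ω) :=
    fun s t => (hN s).prodMk (hN t)
  have : R.pathEvent h i m d = ⋂ k ∈ Finset.range m, (R.J ((k + 1 : ℕ) * h) ⁻¹' {(d k).1} ∩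
      (fun ω => (R.N ((k + 1 : ℕ) * h) ω, R.N ((k : ℕ) * h) ω)) ⁻¹'
        {p | p.1 + moves i d k = p.2 + (d k).2}) := by
    ext ω; simp [pathEvent]
  rw [this]
  refine Finset.measurableSet_biInter _ fun k _ => MeasurableSet.inter ?_ ?_
  · exact hJ _ (measurableSet_singleton _)
  · exact hNN _ _ (Set.to_countable _).measurableSet

/-- The marks determine the state and both counters at every grid point; consequently the numbers of
the claims charged in each cell are no longer random. -/
lemma pathEvent_spec {h : ℝ≥0} {i : Fin n} {m : ℕ} {d : ℕ → Fin n × ℕ} {ω : Ω}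
    (h0 : R.J 0 ω = i) (hω : ω ∈ R.pathEvent h i m d) {k : ℕ} (hk : k ≤ m) :
    R.J ((k : ℕ) * h) ω = startState i d k ∧ R.N ((k : ℕ) * h) ω = arrivalsBefore i d k ∧
      R.gridMoves h k ω = movesBefore i d k := by
  induction k with
  | zero => simp [h0, startState, arrivalsBefore, gridMoves, movesBefore, R.arrivals.zero]
  | succ k ih =>
    obtain ⟨i1, i2, i3⟩ := ih (by omega)
    obtain ⟨h1, h2⟩ := hω k (by omega)
    have h3 : R.N (((k : ℕ) : ℝ≥0) * h) ω ≤ R.N (((k + 1 : ℕ) : ℝ≥0) * h) ω :=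
      R.arrivals.mono ω (grid_mono h k)
    refine ⟨h1, ?_, ?_⟩
    · rw [arrivalsBefore, Finset.sum_range_succ, ← arrivalsBefore]
      omega
    · rw [gridMoves, movesBefore, Finset.sum_range_succ, Finset.sum_range_succ, ← movesBefore,
        ← gridMoves, i3, cellMoves, i1, h1]
      rfl

/-- With the claim numbers fixed by the marks, a cylinder splits into an event of `(J, N)` and an
event of the claims, to which independence applies. -/
lemma gridCell_mem_cyl_iff {h : ℝ≥0} {i : Fin n} {m : ℕ} {d : ℕ → Fin n × ℕ} {B : ℕ → Set ℝ} {ω : Ω}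
    (h0 : R.J 0 ω = i) : R.gridCell h ω ∈ cyl m d B ↔
      ω ∈ R.pathEvent h i m d ∧ ∀ k < m, ∑ t ∈ pathBlock i d k, R.claims t ω ∈
        {z | h * θ.p (startState i d (k + 1)) - z ∈ B k} := by
  have hpath : R.gridCell h ω ∈ cyl m d B → ω ∈ R.pathEvent h i m d := by
    intro H k hk
    have hJ : ∀ k < m, R.J ((k + 1 : ℕ) * h) ω = (d k).1 := fun k hk =>
      congrArg Prod.fst (H k hk).1
    have hs : R.J ((k : ℕ) * h) ω = startState i d k := by
      rcases k with _ | k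
      · simp [h0, startState]
      · exact hJ k (by omega)
    have hc : R.N ((k + 1 : ℕ) * h) ω - R.N ((k : ℕ) * h) ω +
      R.cellMoves ((k : ℕ) * h) ((k + 1 : ℕ) * h) ω = (d k).2 := congrArg Prod.snd (H k hk).1
    have hmv : R.cellMoves ((k : ℕ) * h) ((k + 1 : ℕ) * h) ω = moves i d k := by
      rw [cellMoves, hs, hJ k hk]; rfl
    have h3 : R.N (((k : ℕ) : ℝ≥0) * h) ω ≤ R.N (((k + 1 : ℕ) : ℝ≥0) * h) ω :=
      R.arrivals.mono ω (grid_mono h k)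
    exact ⟨hJ k hk, by omega⟩
  have hval : ω ∈ R.pathEvent h i m d → ∀ k < m, (R.gridCell h ω k).1 = d k ∧
      (R.gridCell h ω k).2 = h * θ.p (startState i d (k + 1)) -
        ∑ t ∈ pathBlock i d k, R.claims t ω := by
    intro H k hk
    obtain ⟨a1, a2, a3⟩ := R.pathEvent_spec h0 H (show k ≤ m by omega)
    obtain ⟨b1, b2, b3⟩ := R.pathEvent_spec h0 H (show k + 1 ≤ m by omega)
    have hmv : R.cellMoves ((k : ℕ) * h) ((k + 1 : ℕ) * h) ω = moves i d k := by
      rw [cellMoves, a1, b1]; rfl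
    have h2 := (H k hk).2
    have h3 : R.N (((k : ℕ) : ℝ≥0) * h) ω ≤ R.N (((k + 1 : ℕ) : ℝ≥0) * h) ω :=
      R.arrivals.mono ω (grid_mono h k)
    refine ⟨Prod.ext (H k hk).1 ?_, ?_⟩
    · simp only [gridCell]
      omega
    · simp only [gridCell]
      rw [cellClaims_eq, a1, b1, a2, b2, b3]
      rfl
  constructor
  · intro H
    refine ⟨hpath H, fun k hk => ?_⟩
    rw [mem_ofPred_eq, ← (hval (hpath H) k hk).2]
    exact (H k hk).2
  · rintro ⟨H1, H2⟩ k hk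
    obtain ⟨v1, v2⟩ := hval H1 k hk
    exact ⟨v1, by rw [v2]; exact H2 k hk⟩

/-- The claims are independent of `(J, N)`, and the two counters never decrease, so different cells
use disjoint blocks of claims and their sums are independent. Renumbering makes each factor depend
only on the start state and the mark of its cell. -/
lemma prob_gridCell {h : ℝ≥0} (hh : 0 < h) (i : Fin n) (m : ℕ) (d : ℕ → Fin n × ℕ)
    (B : ℕ → Set ℝ) (hB : ∀ k, MeasurableSet (B k)) :
    (R.P i).map (R.gridCell h) (cyl m d B) = ∏ k ∈ Finset.range m,
      (R.P (startState i d k) {ω | R.J h ω = (d k).1 ∧ R.N h ω + moves i d k = (d k).2} *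
        R.P (startState i d k) {ω | ∑ t ∈ claimBlock 0 ((d k).2 - moves i d k) 1
          (startState i d k) (startState i d (k + 1)), R.claims t ω ∈
            {z | h * θ.p (startState i d (k + 1)) - z ∈ B k}}) := by
  have hB' : ∀ k, MeasurableSet {z : ℝ | h * θ.p (startState i d (k + 1)) - z ∈ B k} := fun k =>
    (measurable_const.sub measurable_id) (hB k)
  rw [Measure.map_apply (R.measurable_gridCell h) (measurableSet_cyl hB)]
  have e : R.P i (R.gridCell h ⁻¹' cyl m d B) = R.P i ({ω | ∀ k < m,
      ∑ t ∈ pathBlock i d k, R.claims t ω ∈ {z | h * θ.p (startState i d (k + 1)) - z ∈ B k}} ∩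
        R.pathEvent h i m d) := by
    refine measure_congr ?_
    filter_upwards [R.ae_J_zero i] with ω hω
    exact propext ((R.gridCell_mem_cyl_iff hω).trans and_comm)
  have hclaims : MeasurableSet[sigma R.claims] {ω | ∀ k < m,
      ∑ t ∈ pathBlock i d k, R.claims t ω ∈
        {z | h * θ.p (startState i d (k + 1)) - z ∈ B k}} := by
    have : {ω | ∀ k < m, ∑ t ∈ pathBlock i d k, R.claims t ω ∈
        {z | h * θ.p (startState i d (k + 1)) - z ∈ B k}} = ⋂ k ∈ Finset.range m,
        (fun ω => ∑ t ∈ pathBlock i d k, R.claims t ω) ⁻¹'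
          {z | h * θ.p (startState i d (k + 1)) - z ∈ B k} := by
      ext ω; simp
    rw [this]
    refine Finset.measurableSet_biInter _ fun k _ => ?_
    refine (@Finset.measurable_sum _ _ _ _ _ _ (sigma R.claims) _ _ fun t _ =>
      measurable_sigma R.claims t) (hB' k)
  have hmono : Monotone (arrivalsBefore i d) := monotone_nat_of_le_succ fun k => by
    rw [arrivalsBefore, arrivalsBefore, Finset.sum_range_succ]; omega
  have hmono' : Monotone (movesBefore i d) := monotone_nat_of_le_succ fun k => by
    rw [movesBefore, movesBefore, Finset.sum_range_succ]; omega
  have hmove : ∀ k, startState i d k ≠ startState i d (k + 1) →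
      movesBefore i d (k + 1) = movesBefore i d k + 1 := fun k hk => by
    rw [movesBefore, Finset.sum_range_succ, ← movesBefore, moves, if_neg hk]
  have hdisj : ∀ k k', k < k' → Disjoint (pathBlock i d k) (pathBlock i d k') := by
    intro k k' hk
    refine disjoint_claimBlock (hmono hk) fun hne => ?_
    rw [hmove k' hne]
    exact Nat.lt_succ_of_le (hmono' hk)
  rw [e, (Indep_iff _ _ _).1 (R.claims_indep i) _ _ hclaims (R.measurableSet_pathEvent h i m d),
    prob_block_sums (R.claims_iIndep i) R.measurable_claims _ hdisj _ hB', mul_comm,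
    R.prob_pathEvent hh, ← Finset.prod_mul_distrib]
  refine Finset.prod_congr rfl fun k _ => ?_
  congr 1
  have : arrivalsBefore i d (k + 1) = arrivalsBefore i d k + ((d k).2 - moves i d k) := by
    rw [arrivalsBefore, Finset.sum_range_succ, ← arrivalsBefore]
  rw [pathBlock, this]
  exact R.prob_claimBlock i (startState i d k) _ _ _ _ _
    (fun hne => by rw [hmove k hne]; omega) (hB' k)

/-- The formula of `prob_gridCell` with a single cell recognises each factor as a one-cell
probability. -/
lemma renewal_gridCell {h : ℝ≥0} (hh : 0 < h) : Renewal fun i => (R.P i).map (R.gridCell h) := by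
  have hm := R.measurable_gridCell h
  have := R.isProbabilityMeasure_map hm
  refine ProductLaw.renewal fun i m d B hB => ?_
  rw [R.prob_gridCell hh i m d B hB]
  refine Finset.prod_congr rfl fun k _ => ?_
  have := R.prob_gridCell hh (startState i d k) 1 (fun _ => d k) (fun _ => B k) fun _ => hB k
  rw [Finset.prod_range_one] at this
  refine this.symm.trans ?_
  congr 1
  ext x
  simp [cyl, firstSet]

lemma measurable_unitCell : Measurable R.unitCell := by
  refine measurable_pi_lambda _ fun k => ?_
  refine measurable_of_tendsto_metrizable
    (f := fun (l : ℕ) ω => block l (R.gridCell (1 / (l + 1)) ω) k)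
    (fun l => ?_) (tendsto_pi_nhds.2 fun ω => tendsto_block_gridCell ω k)
  exact (measurable_pi_apply k).comp ((measurable_block l).comp (R.measurable_gridCell _))

/-- The risk process has the Markov property at integer times. -/
theorem renewal_unitCell : Renewal fun i => (R.P i).map R.unitCell := by
  have := R.prob
  refine Renewal.of_tendsto (ξ := fun l ω => block l (R.gridCell (1 / (l + 1)) ω))
    (fun l => (measurable_block l).comp (R.measurable_gridCell _)) R.measurable_unitCell
    (fun l => ?_) tendsto_block_gridCell
  have hm := R.measurable_gridCell (1 / (l + 1))
  have := R.isProbabilityMeasure_map hm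
  have h := (R.renewal_gridCell (h := 1 / ((l : ℝ≥0) + 1)) (by positivity)).block l
  simp only [Measure.map_map (measurable_block l) hm] at h
  exact h

end Model

end MMRisk

end

/-! ### From positive drift to the ruin probability. -/

noncomputable section

namespace MMRisk

/-- A diagonal entry of `exp (h Q)` decreases at most linearly near `h = 0`. -/
lemma eventually_le_exp_diag {n : ℕ} (Q : Matrix (Fin n) (Fin n) ℝ) (i : Fin n) :
    ∀ᶠ h : ℝ in 𝓝[>] 0, 1 + (Q i i - 1) * h ≤ NormedSpace.exp (h • Q) i i := by
  let _ : NormedRing (Matrix (Fin n) (Fin n) ℝ) := Matrix.linftyOpNormedRing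
  let _ : NormedAlgebra ℝ (Matrix (Fin n) (Fin n) ℝ) := Matrix.linftyOpNormedAlgebra
  have h1 : HasDerivAt (fun h : ℝ => NormedSpace.exp (h • Q))
      (NormedSpace.exp ((0 : ℝ) • Q) * Q) 0 := hasDerivAt_exp_smul_const Q (0 : ℝ)
  let e : Matrix (Fin n) (Fin n) ℝ →L[ℝ] ℝ :=
    LinearMap.toContinuousLinearMap (Matrix.entryLinearMap ℝ ℝ i i)
  have h2 : HasDerivAt (fun h : ℝ => NormedSpace.exp (h • Q) i i) (Q i i) 0 := by
    have := e.hasFDerivAt.comp_hasDerivAt (0 : ℝ) h1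
    rw [zero_smul, NormedSpace.exp_zero, one_mul] at this
    exact this
  have h3 : NormedSpace.exp ((0 : ℝ) • Q) i i = 1 := by
    rw [zero_smul, NormedSpace.exp_zero, Matrix.one_apply_eq]
  have h4 := (hasDerivAt_iff_tendsto_slope.1 h2).mono_left
    (nhdsWithin_mono 0 fun h (hh : 0 < h) => hh.ne')
  -- The difference quotient tends to `Q i i`, so it eventually exceeds `Q i i - 1`; the loss of 1
  -- is harmless, as only positivity is wanted later.
  filter_upwards [h4.eventually (lt_mem_nhds (sub_one_lt (Q i i))), self_mem_nhdsWithin]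
    with h hh hpos
  have hpos' : 0 < h := hpos
  rw [slope_def_field, h3, sub_zero, lt_div_iff₀ hpos'] at hh
  linarith

namespace Model

variable {n : ℕ} {θ : Params n} {Ω : Type*} [MeasurableSpace Ω] (R : Model θ Ω)

/-! ### A unit interval without events -/

/-- The path between 0 and `h` is not fixed by `J h = i`, but its integrated intensity is at most `Λ
* h` in any case. -/
lemma prob_still {h : ℝ≥0} {Λ : ℝ} (hΛ : ∀ j, θ.lam j ≤ Λ) (i : Fin n) :
    ENNReal.ofReal (Real.exp (-(Λ * h))) *
        ENNReal.ofReal (NormedSpace.exp ((h : ℝ) • θ.Q) i i) ≤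
      R.P i {ω | R.J h ω = i ∧ R.N h ω = 0} := by
  have hJ : R.P i {ω | R.J h ω = i} = ENNReal.ofReal (NormedSpace.exp ((h : ℝ) • θ.Q) i i) := by
    simpa [startState] using R.prob_J_grid h i 1 fun _ => (i, 0)
  have hA : MeasurableSet[sigma R.J] {ω | R.J h ω = i} :=
    measurable_sigma R.J h (measurableSet_singleton i)
  have hlaw := R.arrivals.law i 1 (fun k => (k : ℝ≥0) * h) (fun _ => 0) _ (monotone_grid h) hA
  have e : {ω | R.J h ω = i} ∩ {ω | ∀ k < 1, R.N ((k + 1 : ℕ) * h) ω = R.N ((k : ℕ) * h) ω + 0} =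
      {ω | R.J h ω = i ∧ R.N h ω = 0} := by
    ext ω
    simp [R.arrivals.zero]
  rw [e] at hlaw
  rw [hlaw, ← hJ, ← setLIntegral_const]
  refine lintegral_mono fun ω => ?_
  simp only [Finset.prod_range_one, pow_zero, Nat.factorial_zero, Nat.cast_one, mul_one, div_one]
  refine ENNReal.ofReal_le_ofReal (Real.exp_le_exp.2 (neg_le_neg ?_))
  have h0 : (((0 : ℕ) : ℝ≥0) * h : ℝ≥0) ≤ (((0 + 1 : ℕ) : ℝ≥0) * h : ℝ≥0) := grid_mono h 0
  have := intervalIntegral.integral_mono_on (NNReal.coe_le_coe.2 h0)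
    (intervalIntegrable_comp_rightCont (R.chain.rightCont ω) θ.lam _ _)
    (intervalIntegrable_const (c := Λ)) fun u _ => hΛ _
  refine this.trans (le_of_eq ?_)
  rw [intervalIntegral.integral_const]
  simp [mul_comm]

lemma prob_still_grid {h : ℝ≥0} (hh : 0 < h) (i : Fin n) (m : ℕ) :
    R.P i {ω | ∀ k < m, R.J ((k + 1 : ℕ) * h) ω = i ∧
      R.N ((k + 1 : ℕ) * h) ω = R.N ((k : ℕ) * h) ω + 0} =
    R.P i {ω | R.J h ω = i ∧ R.N h ω = 0} ^ m := by
  rw [R.prob_JN_grid hh i m (fun _ => (i, 0)) fun _ => 0]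
  rw [Finset.prod_congr rfl fun k _ => by
    rw [show startState i (fun _ => (i, 0)) k = i by cases k <;> rfl]]
  simp

lemma block_mark_of_still {l : ℕ} {i : Fin n} {ω : Ω} (h0 : R.J 0 ω = i)
    (h : ∀ k < l + 1, R.J ((k + 1 : ℕ) * (1 / ((l : ℝ≥0) + 1))) ω = i ∧
      R.N ((k + 1 : ℕ) * (1 / ((l : ℝ≥0) + 1))) ω =
        R.N ((k : ℕ) * (1 / ((l : ℝ≥0) + 1))) ω + 0) :
    (block l (R.gridCell (1 / (l + 1)) ω) 0).1 = (i, 0) := by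
  have hJ : ∀ k ≤ l + 1, R.J ((k : ℕ) * (1 / ((l : ℝ≥0) + 1))) ω = i := by
    rintro (_ | k) hk
    · simpa using h0
    · exact (h k (by omega)).1
  simp only [block, agg, iterate_shift, gridCell, zero_mul, add_zero]
  refine Prod.ext (hJ (l + 1) le_rfl) ?_
  dsimp only
  refine Finset.sum_eq_zero fun a ha => ?_
  have ha := Finset.mem_range.1 ha
  rw [(h a ha).2, cellMoves, hJ a (by omega), hJ (a + 1) (by omega)]
  simp

/-- With `h = 1 / (l + 1)`, staying still at all grid points has probability at least `(exp (-Λ h) *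
(1 + c h)) ^ (l + 1)` for fine grids, which tends to `exp (-Λ) * exp c > 0`. This bound is uniform
in the mesh, and the aggregated marks eventually equal the unit mark on every path, so it passes to
the limit. -/
lemma prob_unitCell_still_pos (i : Fin n) :
    0 < (R.P i).map R.unitCell (firstSet (i, 0) univ) := by
  have := R.prob i
  obtain ⟨Λ, hΛ⟩ : ∃ Λ, ∀ j, θ.lam j ≤ Λ := by
    obtain ⟨Λ, hΛ⟩ := (Set.finite_range θ.lam).bddAbove
    exact ⟨Λ, fun j => hΛ ⟨j, rfl⟩⟩
  set c := θ.Q i i - 1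
  have hS : ∀ l : ℕ, MeasurableSet {ω | (block l (R.gridCell (1 / (l + 1)) ω) 0).1 = (i, 0)} := by
    intro l
    have h1 : Measurable fun ω => (block l (R.gridCell (1 / (l + 1)) ω) 0).1 :=
      measurable_fst.comp ((measurable_pi_apply 0).comp
        ((measurable_block l).comp (R.measurable_gridCell _)))
    exact h1 (measurableSet_singleton _)
  have hU : MeasurableSet {ω | (R.unitCell ω 0).1 = (i, 0)} :=
    (measurable_fst.comp ((measurable_pi_apply 0).comp R.measurable_unitCell))
      (measurableSet_singleton (i, 0))
  have hlim : Tendsto (fun l : ℕ =>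
      R.P i {ω | (block l (R.gridCell (1 / (l + 1)) ω) 0).1 = (i, 0)}) atTop
      (𝓝 (R.P i {ω | (R.unitCell ω 0).1 = (i, 0)})) := by
    refine tendsto_measure_of_tendsto_indicator_of_isFiniteMeasure atTop _ hS ?_
    refine fun ω => ?_
    have h1 := (continuous_fst.tendsto _).comp (tendsto_block_gridCell (R := R) ω 0)
    have h2 : ∀ᶠ l : ℕ in atTop,
        (block l (R.gridCell (1 / (l + 1)) ω) 0).1 = (R.unitCell ω 0).1 :=
      h1.eventually (p := fun v => v = (R.unitCell ω 0).1) (by simp)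
    filter_upwards [h2] with l hl
    simp only [hl]
  have hmesh : Tendsto (fun l : ℕ => 1 / ((l : ℝ) + 1)) atTop (𝓝[>] 0) := by
    refine tendsto_nhdsWithin_iff.2 ⟨tendsto_one_div_add_atTop_nhds_zero_nat, ?_⟩
    exact Eventually.of_forall fun l => by simp only [mem_Ioi]; positivity
  have hpow : Tendsto (fun l : ℕ => (1 + c * (1 / ((l : ℝ) + 1))) ^ (l + 1)) atTop
      (𝓝 (Real.exp c)) := by
    have := (Real.tendsto_one_add_div_pow_exp c).comp (tendsto_add_atTop_nat 1)
    refine this.congr fun l => ?_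
    simp only [Function.comp_apply, Nat.cast_add, Nat.cast_one]
    rw [mul_one_div]
  have hpos : ∀ᶠ l : ℕ in atTop, 0 < 1 + c * (1 / ((l : ℝ) + 1)) := by
    have : Tendsto (fun l : ℕ => 1 + c * (1 / ((l : ℝ) + 1))) atTop (𝓝 (1 + c * 0)) :=
      (tendsto_one_div_add_atTop_nhds_zero_nat.const_mul c).const_add 1
    exact this.eventually (lt_mem_nhds (by simp))
  have hbound : ∀ᶠ l : ℕ in atTop, ENNReal.ofReal (Real.exp (-Λ) * (Real.exp c / 2)) ≤
      R.P i {ω | (block l (R.gridCell (1 / (l + 1)) ω) 0).1 = (i, 0)} := by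
    filter_upwards [hmesh.eventually (eventually_le_exp_diag θ.Q i), hpos,
      hpow.eventually (lt_mem_nhds (half_lt_self (Real.exp_pos c)))] with l h1 h2 h3
    have hl : ((1 / ((l : ℝ≥0) + 1) : ℝ≥0) : ℝ) = 1 / ((l : ℝ) + 1) := by push_cast; rfl
    calc ENNReal.ofReal (Real.exp (-Λ) * (Real.exp c / 2))
        ≤ ENNReal.ofReal ((Real.exp (-(Λ * (1 / ((l : ℝ) + 1)))) *
            (1 + c * (1 / ((l : ℝ) + 1)))) ^ (l + 1)) := by
          refine ENNReal.ofReal_le_ofReal ?_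
          rw [mul_pow, ← Real.exp_nat_mul]
          have : ((l + 1 : ℕ) : ℝ) * -(Λ * (1 / ((l : ℝ) + 1))) = -Λ := by
            push_cast; field_simp
          rw [this]
          gcongr
      _ ≤ R.P i {ω | R.J (1 / ((l : ℝ≥0) + 1)) ω = i ∧
            R.N (1 / ((l : ℝ≥0) + 1)) ω = 0} ^ (l + 1) := by
          rw [ENNReal.ofReal_pow (by positivity)]
          refine pow_le_pow_left₀ zero_le ?_ _
          rw [ENNReal.ofReal_mul (Real.exp_pos _).le]
          have := R.prob_still (h := 1 / ((l : ℝ≥0) + 1)) hΛ i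
          rw [hl] at this
          exact le_trans (by gcongr) this
      _ = _ := (R.prob_still_grid (by positivity) i (l + 1)).symm
      _ ≤ _ := by
          refine measure_mono_ae ?_
          filter_upwards [R.ae_J_zero i] with ω hω H
          exact R.block_mark_of_still hω H
  rw [Measure.map_apply R.measurable_unitCell (measurableSet_firstSet _ MeasurableSet.univ)]
  have e : R.unitCell ⁻¹' firstSet (i, 0) univ = {ω | (R.unitCell ω 0).1 = (i, 0)} := by
    ext ω; simp [firstSet]
  rw [e]
  exact (ENNReal.ofReal_pos.2 (by positivity)).trans_le (ge_of_tendsto hlim hbound)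

/-! ### Ruin and the maximum of the walk -/

lemma claimSum_zero (ω : Ω) : R.claimSum 0 ω = 0 := by
  have h : R.envCount 0 ω = 0 := cnt_zero (zero_notMem_jumpSet _)
  simp [claimSum, h, R.arrivals.zero]

lemma X_zero (x : ℝ) (ω : Ω) : R.X x 0 ω = x := by
  simp [X_eq, R.claimSum_zero]

lemma X_eq_add (x : ℝ) (t : ℝ≥0) (ω : Ω) : R.X x t ω = x + R.X 0 t ω := by
  rw [X_eq, X_eq]; ring

/-- The steps telescope. An infinite epoch is sent to time 0 by `toNNReal`, giving the value 0 of
the walk at index 0; such indices affect neither the maximum nor the ruin criterion. -/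
lemma walk_eq (m : ℕ) (ω : Ω) : R.walk m ω = -R.X 0 (R.claimEpoch m ω).toNNReal ω := by
  induction m with
  | zero => simp [walk, claimEpoch, epoch, R.X_zero]
  | succ m ih =>
    rw [walk, Finset.sum_Icc_succ_top (by omega), ← walk, ih, step]
    simp
    ring

lemma claimEpoch_le_iff (k : ℕ) (t : ℝ≥0) (ω : Ω) :
    R.claimEpoch k ω ≤ t ↔ k ≤ cnt (R.jumps ω) t :=
  epoch_le_iff (R.zero_notMem_jumps ω) (R.finite_jumps ω) k t

/-- Between claims the risk process increases. -/
lemma X_claimEpoch_le (x : ℝ) (t : ℝ≥0) (ω : Ω) :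
    R.X x (R.claimEpoch (cnt (R.jumps ω) t) ω).toNNReal ω ≤ R.X x t ω := by
  have hle : R.claimEpoch (cnt (R.jumps ω) t) ω ≤ t := (R.claimEpoch_le_iff _ _ _).2 le_rfl
  obtain ⟨e, he⟩ : ∃ e : ℝ≥0, R.claimEpoch (cnt (R.jumps ω) t) ω = e :=
    ⟨_, (ENNReal.coe_toNNReal (hle.trans_lt ENNReal.coe_lt_top).ne).symm⟩
  have h1 : cnt (R.jumps ω) t ≤ cnt (R.jumps ω) e := (R.claimEpoch_le_iff _ _ _).1 he.le
  rw [he] at hle ⊢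
  have hle' : e ≤ t := by exact_mod_cast hle
  have hempty : R.jumps ω ∩ Ioc e t = ∅ := by
    ext u
    simp only [mem_inter_iff, mem_Ioc, mem_empty_iff_false, iff_false]
    rintro ⟨hu, hu1, hu2⟩
    have := cnt_lt_cnt (R.finite_jumps ω) hu1 hu
    have := cnt_mono (R.finite_jumps ω) hu2
    omega
  have hclaims : R.claimSum t ω = R.claimSum e ω := by
    have hN : R.N t ω = R.N e ω := by
      rw [R.N_eq_cnt t, R.N_eq_cnt e]
      exact cnt_eq_of_empty hle' (subset_eq_empty
        (inter_subset_inter_left _ subset_union_left) hempty)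
    have hE : R.envCount t ω = R.envCount e ω :=
      cnt_eq_of_empty hle' (subset_eq_empty
        (inter_subset_inter_left _ subset_union_right) hempty)
    rw [claimSum, claimSum, hN, hE]
  have := X_sub_X (R := R) x e t ω
  have hint : 0 ≤ ∫ u in (e : ℝ)..(t : ℝ), θ.p (R.J u.toNNReal ω) :=
    intervalIntegral.integral_nonneg (NNReal.coe_le_coe.2 hle') fun u _ => (θ.p_pos _).le
  rw [ENNReal.toNNReal_coe]
  linarith

/-- Ruin occurs if and only if the maximum of the embedded walk exceeds the initial capital. -/
lemma ruinTime_lt_top_iff (x : ℝ) (ω : Ω) :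
    R.ruinTime x ω < ∞ ↔ (x : EReal) < R.walkMax ω := by
  rw [walkMax, lt_iSup_iff]
  simp only [ruinTime, iInf_lt_iff, EReal.coe_lt_coe_iff, walk_eq]
  constructor
  · rintro ⟨t, ht, -⟩
    refine ⟨cnt (R.jumps ω) t, ?_⟩
    have := R.X_claimEpoch_le x t ω
    rw [X_eq_add] at this
    linarith
  · rintro ⟨m, hm⟩
    refine ⟨(R.claimEpoch m ω).toNNReal, ?_, ENNReal.coe_lt_top⟩
    rw [X_eq_add]
    linarith

lemma exists_walkMax_eq {ω : Ω} (h : ∃ T : ℝ≥0, ∀ t, T ≤ t → 0 ≤ R.X 0 t ω) :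
    ∃ m : ℕ, R.walkMax ω = (R.walk m ω : EReal) := by
  obtain ⟨T, hT⟩ := h
  have hlate : ∀ m, cnt (R.jumps ω) T < m → R.walk m ω ≤ R.walk 0 ω := by
    intro m hm
    have h0 : R.walk 0 ω = 0 := by simp [walk]
    rw [h0, walk_eq, neg_nonpos]
    by_cases htop : R.claimEpoch m ω = ∞
    · rw [htop, ENNReal.toNNReal_top, R.X_zero]
    · refine hT _ (not_lt.1 fun hlt => ?_)
      have h1 : R.claimEpoch m ω ≤ T := by
        rw [← ENNReal.coe_toNNReal htop]
        exact_mod_cast hlt.le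
      have := (R.claimEpoch_le_iff _ _ _).1 h1
      omega
  obtain ⟨m₀, -, hm₀⟩ := Finset.exists_max_image (Finset.range (cnt (R.jumps ω) T + 1))
    (fun m => R.walk m ω) ⟨0, by simp⟩
  refine ⟨m₀, le_antisymm (iSup_le fun m => EReal.coe_le_coe_iff.2 ?_)
    (le_iSup (fun m => (R.walk m ω : EReal)) m₀)⟩
  rcases le_or_gt m (cnt (R.jumps ω) T) with hm | hm
  · exact hm₀ m (Finset.mem_range.2 (by omega))
  · exact (hlate m hm).trans (hm₀ 0 (by simp))

/-! ### Drift to infinity -/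

lemma ae_claims_nonneg (i : Fin n) : ∀ᵐ ω ∂(R.P i), ∀ t, 0 ≤ R.claims t ω := by
  refine ae_all_iff.2 fun t => ?_
  have key : ∀ (ν : Measure ℝ), (R.P i).map (R.claims t) = ν → ν (Iio 0) = 0 →
      ∀ᵐ ω ∂(R.P i), 0 ≤ R.claims t ω := by
    intro ν h1 h2
    rw [← h1, Measure.map_apply (R.measurable_claims t) measurableSet_Iio] at h2
    rw [ae_iff]
    simpa only [not_le] using! h2
  rcases t with ⟨k, j⟩ | ⟨k, j, l⟩
  · exact key _ (R.C_law i k j) (θ.F_nonneg j)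
  · exact key _ (R.D_law i k j l) (θ.G_nonneg j l)

variable {R}

lemma claimSum_mono {ω : Ω} (h : ∀ t, 0 ≤ R.claims t ω) : Monotone fun t => R.claimSum t ω := by
  intro s t hst
  refine add_le_add ?_ ?_
  · refine Finset.sum_le_sum_of_subset_of_nonneg
      (Finset.Icc_subset_Icc_right (R.arrivals.mono ω hst)) fun k _ _ => h (Sum.inl (k, _))
  · refine Finset.sum_le_sum_of_subset_of_nonneg
      (Finset.Icc_subset_Icc_right (R.envCount_mono ω hst)) fun k _ _ => h (Sum.inr (k, _, _))

/-- Within a unit interval the risk process exceeds its final value up to the premiums. -/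
lemma X_ge_next {ω : Ω} (h : ∀ t, 0 ≤ R.claims t ω) {C : ℝ} (hC : ∀ j, θ.p j ≤ C) (hC0 : 0 ≤ C)
    (t : ℝ≥0) : R.X 0 ((⌊t⌋₊ + 1 : ℕ) : ℝ≥0) ω - C ≤ R.X 0 t ω := by
  have h1 : t ≤ ((⌊t⌋₊ + 1 : ℕ) : ℝ≥0) := by
    push_cast; exact (Nat.lt_floor_add_one t).le
  have h2 : ((⌊t⌋₊ : ℕ) : ℝ≥0) ≤ t := Nat.floor_le zero_le
  have hX := X_sub_X (R := R) 0 t ((⌊t⌋₊ + 1 : ℕ) : ℝ≥0) ω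
  have hmono : R.claimSum t ω ≤ R.claimSum ((⌊t⌋₊ + 1 : ℕ) : ℝ≥0) ω := claimSum_mono h h1
  have hint := intervalIntegral.integral_mono_on (NNReal.coe_le_coe.2 h1)
    (intervalIntegrable_comp_rightCont (R.chain.rightCont ω) θ.p _ _)
    (intervalIntegrable_const (c := C)) fun u _ => hC _
  rw [intervalIntegral.integral_const, smul_eq_mul] at hint
  have h3 : ((((⌊t⌋₊ + 1 : ℕ) : ℝ≥0) : ℝ) - t) ≤ 1 := by
    have : ((⌊t⌋₊ : ℕ) : ℝ) ≤ (t : ℝ) := by exact_mod_cast h2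
    push_cast
    linarith
  have h4 := mul_le_mul_of_nonneg_right h3 hC0
  linarith

variable (R)

lemma sum_unitCell (ω : Ω) (b m : ℕ) : ∑ k ∈ Finset.range m, (R.unitCell ω (k + b)).2 =
    R.X 0 (m + b : ℕ) ω - R.X 0 (b : ℕ) ω := by
  induction m with
  | zero => simp
  | succ m ih =>
    rw [Finset.sum_range_succ, ih]
    simp only [unitCell]
    rw [show m + 1 + b = m + b + 1 by ring]
    ring

lemma ae_tendsto_unitCell (hprofit : R.NetProfit) (i : Fin n) :
    ∀ᵐ x ∂((R.P i).map R.unitCell),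
      Tendsto (fun m => ∑ k ∈ Finset.range m, (x k).2) atTop atTop := by
  have := R.isProbabilityMeasure_map R.measurable_unitCell
  refine R.renewal_unitCell.tendsto_sum (fun j => ?_) i
  have hm : Measurable fun x : ℕ → Site n => (x 0).2 := by fun_prop
  rw [integral_map R.measurable_unitCell.aemeasurable hm.aestronglyMeasurable]
  refine (hprofit j).trans_eq (integral_congr_ae (Eventually.of_forall fun ω => ?_))
  simp [unitCell, R.X_zero]

lemma ae_tendsto_X (hprofit : R.NetProfit) (i : Fin n) :
    ∀ᵐ ω ∂(R.P i), Tendsto (fun m : ℕ => R.X 0 (m : ℝ≥0) ω) atTop atTop := by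
  filter_upwards [ae_of_ae_map R.measurable_unitCell.aemeasurable
    (R.ae_tendsto_unitCell hprofit i)] with ω hω
  refine hω.congr fun m => ?_
  have := R.sum_unitCell ω 0 m
  simpa [R.X_zero] using this

lemma exists_premium_bound (θ : Params n) : ∃ C, (∀ j, θ.p j ≤ C) ∧ 0 ≤ C := by
  obtain ⟨C, hC⟩ := (Set.finite_range θ.p).bddAbove
  exact ⟨max C 0, fun j => (hC ⟨j, rfl⟩).trans (le_max_left _ _), le_max_right _ _⟩

lemma ae_eventually_X_nonneg (hprofit : R.NetProfit) (i : Fin n) :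
    ∀ᵐ ω ∂(R.P i), ∃ T : ℝ≥0, ∀ t, T ≤ t → 0 ≤ R.X 0 t ω := by
  obtain ⟨C, hC, hC0⟩ := exists_premium_bound θ
  filter_upwards [R.ae_tendsto_X hprofit i, R.ae_claims_nonneg i] with ω h1 h2
  obtain ⟨M, hM⟩ := eventually_atTop.1 (h1.eventually_ge_atTop C)
  refine ⟨M, fun t ht => ?_⟩
  have h3 := X_ge_next h2 hC hC0 t
  have h4 := hM (⌊t⌋₊ + 1) ((Nat.le_floor ht).trans (Nat.le_succ _))
  linarith

/-! ### Ruin is not certain -/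

/-- The cell sequences whose partial sums of increments stay above `-K`. -/
def boundedBelow (n : ℕ) (K : ℝ) : Set (ℕ → Site n) :=
  {x | ∀ m, -K ≤ ∑ k ∈ Finset.range m, (x k).2}

lemma measurableSet_boundedBelow (K : ℝ) : MeasurableSet (boundedBelow n K) := by
  have : boundedBelow n K = ⋂ m, {x | -K ≤ ∑ k ∈ Finset.range m, (x k).2} := by
    ext x; simp [boundedBelow]
  rw [this]
  exact MeasurableSet.iInter fun m => measurableSet_le measurable_const (by fun_prop)

/-- Sums tending to infinity are bounded below, so these sets exhaust almost all sequences and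
cannot all be null. -/
lemma exists_prob_boundedBelow_pos (hprofit : R.NetProfit) (i : Fin n) :
    ∃ K₀ : ℕ, 0 < (R.P i).map R.unitCell (boundedBelow n K₀) := by
  have := R.isProbabilityMeasure_map R.measurable_unitCell i
  by_contra hc
  push Not at hc
  have h1 : (R.P i).map R.unitCell (⋃ K₀ : ℕ, boundedBelow n K₀) = 0 :=
    measure_iUnion_null fun K₀ => nonpos_iff_eq_zero.1 (hc K₀)
  have h2 : ∀ᵐ x ∂((R.P i).map R.unitCell), x ∈ ⋃ K₀ : ℕ, boundedBelow n K₀ := by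
    filter_upwards [R.ae_tendsto_unitCell hprofit i] with x hx
    obtain ⟨b, hb⟩ := bddBelow_range_of_tendsto_atTop_atTop hx
    obtain ⟨K₀, hK₀⟩ := exists_nat_ge (-b)
    refine mem_iUnion.2 ⟨K₀, fun m => ?_⟩
    have := hb ⟨m, rfl⟩
    linarith
  have h3 : ∀ᵐ x ∂((R.P i).map R.unitCell), x ∉ ⋃ K₀ : ℕ, boundedBelow n K₀ :=
    measure_eq_zero_iff_ae_notMem.1 h1
  obtain ⟨x, hx, hx'⟩ := (h2.and h3).exists
  exact hx' hx

/-- A still cell ends in its starting state `i`, so the Markov additive property restarts the same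
law each time. -/
lemma prob_still_then (i : Fin n) (M : ℕ) {A : Set (ℕ → Site n)} (hA : MeasurableSet A) :
    (R.P i).map R.unitCell {x | (∀ k < M, (x k).1 = (i, 0)) ∧ shift^[M] x ∈ A} =
      (R.P i).map R.unitCell (firstSet (i, 0) univ) ^ M * (R.P i).map R.unitCell A := by
  induction M with
  | zero => simp
  | succ M ih =>
    have e : {x : ℕ → Site n | (∀ k < M + 1, (x k).1 = (i, 0)) ∧ shift^[M + 1] x ∈ A} =
        firstSet (i, 0) univ ∩
          shift ⁻¹' {x | (∀ k < M, (x k).1 = (i, 0)) ∧ shift^[M] x ∈ A} := by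
      ext x
      simp only [firstSet, mem_ofPred_eq, mem_inter_iff, mem_preimage, mem_univ, and_true,
        Function.iterate_succ_apply]
      constructor
      · rintro ⟨h1, h2⟩
        exact ⟨h1 0 (by omega), fun k hk => h1 (k + 1) (by omega), h2⟩
      · rintro ⟨h1, h2, h3⟩
        refine ⟨?_, h3⟩
        rintro (_ | k) hk
        · exact h1
        · exact h2 k (by omega)
    have hm : MeasurableSet {x : ℕ → Site n |
        (∀ k < M, (x k).1 = (i, 0)) ∧ shift^[M] x ∈ A} := by
      have : {x : ℕ → Site n | (∀ k < M, (x k).1 = (i, 0)) ∧ shift^[M] x ∈ A} =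
          cyl M (fun _ => (i, 0)) (fun _ => univ) ∩ shift^[M] ⁻¹' A := by
        ext x; simp [cyl]
      rw [this]
      exact (measurableSet_cyl fun _ => MeasurableSet.univ).inter (measurable_iterate_shift M hA)
    rw [e, R.renewal_unitCell i (i, 0) univ _ MeasurableSet.univ hm, ih, pow_succ', mul_assoc]

lemma counts_eq_zero {M : ℕ} {i : Fin n} {ω : Ω}
    (h : ∀ k < M, (R.unitCell ω k).1 = (i, 0)) : R.N M ω = 0 ∧ R.envCount M ω = 0 := by
  induction M with
  | zero =>
    exact ⟨by simpa using R.arrivals.zero ω, by simpa using! cnt_zero (zero_notMem_jumpSet _)⟩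
  | succ M ih =>
    obtain ⟨h1, h2⟩ := ih fun k hk => h k (by omega)
    have h3 : (R.N (M + 1 : ℕ) ω - R.N (M : ℕ) ω) +
      (R.envCount (M + 1 : ℕ) ω - R.envCount (M : ℕ) ω) = 0 :=
      congrArg Prod.snd (h M (by omega))
    omega

/-- Up to time `M` there are premiums and no claims, so `X` reaches at least `c * M`. At later
integer times it is at least `c * M - (c * M - C) = C`, and by `X_ge_next` it lies at most `C` lower
at the times in between. -/
lemma X_nonneg_of_still {M : ℕ} {i : Fin n} {ω : Ω} {c C : ℝ} (hc : ∀ j, c ≤ θ.p j)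
    (hC : ∀ j, θ.p j ≤ C) (hC0 : 0 ≤ C) (hclaims : ∀ t, 0 ≤ R.claims t ω)
    (hstill : ∀ k < M, (R.unitCell ω k).1 = (i, 0))
    (hlater : shift^[M] (R.unitCell ω) ∈ boundedBelow n (c * M - C)) (t : ℝ≥0) :
    0 ≤ R.X 0 t ω := by
  obtain ⟨hN, hE⟩ := R.counts_eq_zero hstill
  have hclaim : ∀ t : ℝ≥0, t ≤ M → R.claimSum t ω = 0 := by
    intro t ht
    have h1 : R.N t ω = 0 := Nat.le_zero.1 (hN ▸ R.arrivals.mono ω ht)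
    have h2 : R.envCount t ω = 0 := Nat.le_zero.1 (hE ▸ R.envCount_mono ω ht)
    simp [claimSum, h1, h2]
  rcases le_total t M with ht | ht
  · rw [X_eq, hclaim t ht, zero_add, sub_zero]
    exact intervalIntegral.integral_nonneg t.coe_nonneg fun u _ => (θ.p_pos _).le
  · have hXM : c * M ≤ R.X 0 (M : ℝ≥0) ω := by
      rw [X_eq, hclaim M le_rfl, zero_add, sub_zero]
      have := intervalIntegral.integral_mono_on (NNReal.coe_nonneg (M : ℝ≥0))
        (intervalIntegrable_const (c := c))
        (intervalIntegrable_comp_rightCont (R.chain.rightCont ω) θ.p _ _) fun u _ => hc _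
      refine le_trans (le_of_eq ?_) this
      simp [mul_comm]
    have h1 := X_ge_next hclaims hC hC0 t
    have hM : M ≤ ⌊t⌋₊ + 1 := (Nat.le_floor ht).trans (Nat.le_succ _)
    have h2 := hlater (⌊t⌋₊ + 1 - M)
    simp only [iterate_shift] at h2
    rw [R.sum_unitCell, Nat.sub_add_cancel hM] at h2
    linarith

lemma exists_prob_no_ruin_pos (hprofit : R.NetProfit) (i : Fin n) :
    ∃ G : Set Ω, MeasurableSet G ∧ 0 < R.P i G ∧ ∀ᵐ ω ∂(R.P i), ω ∈ G → ∀ t, 0 ≤ R.X 0 t ω := by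
  obtain ⟨C, hC, hC0⟩ := exists_premium_bound θ
  obtain ⟨j₀, -, hj₀⟩ := Finset.exists_min_image Finset.univ θ.p ⟨i, Finset.mem_univ i⟩
  set c := θ.p j₀
  have hc : 0 < c := θ.p_pos j₀
  obtain ⟨K₀, hK₀⟩ := R.exists_prob_boundedBelow_pos hprofit i
  -- The choice gives `K₀ ≤ c * M - C`: premiums earned before time `M` cover the later drawdown
  -- `K₀` and the loss `C` within a unit interval.
  obtain ⟨M, hM⟩ := exists_nat_ge ((K₀ + C) / c)
  rw [div_le_iff₀ hc] at hM
  have hmeas := measurableSet_boundedBelow (n := n) (c * M - C)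
  have hsub : boundedBelow n K₀ ⊆ boundedBelow n (c * M - C) := fun x hx m => by
    have := hx m
    linarith
  have hset : MeasurableSet {x : ℕ → Site n | (∀ k < M, (x k).1 = (i, 0)) ∧
      shift^[M] x ∈ boundedBelow n (c * M - C)} := by
    have : {x : ℕ → Site n | (∀ k < M, (x k).1 = (i, 0)) ∧
        shift^[M] x ∈ boundedBelow n (c * M - C)} =
        cyl M (fun _ => (i, 0)) (fun _ => univ) ∩ shift^[M] ⁻¹' boundedBelow n (c * M - C) := by
      ext x; simp [cyl]
    rw [this]
    exact (measurableSet_cyl fun _ => MeasurableSet.univ).inter (measurable_iterate_shift M hmeas)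
  refine ⟨_, R.measurable_unitCell hset, ?_, ?_⟩
  · rw [← Measure.map_apply R.measurable_unitCell hset, R.prob_still_then i M hmeas]
    exact ENNReal.mul_pos (pow_ne_zero _ (R.prob_unitCell_still_pos i).ne')
      (hK₀.trans_le (measure_mono hsub)).ne'
  · filter_upwards [R.ae_claims_nonneg i] with ω hω hG
    exact R.X_nonneg_of_still (fun j => hj₀ j (Finset.mem_univ j)) hC hC0 hω hG.1 hG.2

lemma ruinProb_lt_one (hprofit : R.NetProfit) (i : Fin n) {x : ℝ} (hx : 0 ≤ x) :
    R.ruinProb i x < 1 := by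
  have := R.prob i
  obtain ⟨G, hG, hpos, hno⟩ := R.exists_prob_no_ruin_pos hprofit i
  calc R.ruinProb i x ≤ R.P i Gᶜ := by
        refine measure_mono_ae ?_
        filter_upwards [hno] with ω hω hruin hmem
        have hruin : R.ruinTime x ω < ∞ := hruin
        simp only [ruinTime, iInf_lt_iff] at hruin
        obtain ⟨t, ht, -⟩ := hruin
        rw [X_eq_add] at ht
        have := hω hmem t
        linarith
    _ < 1 := by
        rw [prob_compl_eq_one_sub hG]
        exact ENNReal.sub_lt_self ENNReal.one_ne_top one_ne_zero hpos.ne'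

end Model

end MMRisk

end

theorem theorem4p6 {n : ℕ} (θ : MMRisk.Params n) {Ω : Type*} [MeasurableSpace Ω]
    (R : MMRisk.Model θ Ω) (hprofit : R.NetProfit) (i : Fin n) (x : ℝ) (hx : 0 ≤ x) :
    (∀ᵐ ω ∂(R.P i), ∃ m : ℕ, R.walkMax ω = (R.walk m ω : EReal)) ∧
    R.ruinProb i x = R.P i {ω | (x : EReal) < R.walkMax ω} ∧
    R.P i {ω | (x : EReal) < R.walkMax ω} < 1 := by
  have heq : R.ruinProb i x = R.P i {ω | (x : EReal) < R.walkMax ω} := by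
    simp only [MMRisk.Model.ruinProb, R.ruinTime_lt_top_iff]
  refine ⟨?_, heq, heq ▸ R.ruinProb_lt_one hprofit i hx⟩
  filter_upwards [R.ae_eventually_X_nonneg hprofit i] with ω hω
  exact R.exists_walkMax_eq hω
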